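/- The hypercube $Q_d$ is the graph whose vertices are the subsets of $\{1,\dots,d\}$, two of them being adjacent if they differ in exactly one element. A 1-factorization of a graph is a partition of its edges into perfect matchings (1-factors). For a 1-factorization $\mathcal M=\{M_1,\dots,M_d\}$ of $Q_d$, let $G[\mathcal M]$ be the graph with vertices $M_1,\dots,M_d$ in which two distinct 1-factors $M_i,M_j$ are adjacent if and only if $M_i\cup M_j$ is a Hamilton cycle of $Q_d$. **Theorem.** For all integers $k,l\ge 1$ with $(k,l)\neq(3,3)$, there is a 1-factorization $\mathcal M=\{M_1,\dots,M_{k+l}\}$ of the hypercube $Q_{k+l}$ such that $G[\mathcal M]$ is isomorphic to the complete bipartite graph $K_{k,l}$; moreover, the 1-factors can be labelled so that $\mathcal M$ is $k$-semi-perfect, i.e. $M_i\cup M_j$ is a Hamilton cycle of $Q_{k+l}$ whenever $1\le i\le k<j\le k+l$. -/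

import Mathlib

/-- The hypercube graph `Q_d`: its vertices are the subsets of a `d`-element set, and two of them
are adjacent when they differ in exactly one element. -/
def hypercube (d : ℕ) : SimpleGraph (Finset (Fin d)) where
  Adj s t := (symmDiff s t).card = 1
  symm := ⟨fun s t h => by rwa [symmDiff_comm]⟩
  loopless := ⟨fun s h => by simp at h⟩

/-- A 1-factorization of `G` with 1-factors labelled by `ι`: a family of perfect matchings of `G`
such that every edge of `G` lies in exactly one of them. -/
structure OneFactorization {V : Type*} (G : SimpleGraph V) (ι : Type*) where
  factor : ι → G.Subgraph
  isPerfectMatching : ∀ i, (factor i).IsPerfectMatching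
  existsUnique_factor : ∀ e ∈ G.edgeSet, ∃! i, e ∈ (factor i).edgeSet

/-- The subgraph `H` of `G` is a Hamilton cycle of `G`: it consists of the vertices and edges
of a closed walk that is a cycle visiting every vertex of `G`. -/
def IsHamiltonCycleSubgraph {V : Type*} [DecidableEq V] {G : SimpleGraph V}
    (H : G.Subgraph) : Prop :=
  ∃ (v : V) (p : G.Walk v v), p.IsHamiltonianCycle ∧ p.toSubgraph = H

/-- The graph `G[𝓜]` of a 1-factorization `𝓜`: its vertices are the (labels of the) 1-factors,
and two distinct 1-factors are adjacent when their union is a Hamilton cycle. -/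
def OneFactorization.hamiltonPairGraph {V : Type*} [DecidableEq V] {G : SimpleGraph V}
    {ι : Type*} (M : OneFactorization G ι) : SimpleGraph ι where
  Adj i j := i ≠ j ∧ IsHamiltonCycleSubgraph (M.factor i ⊔ M.factor j)
  symm := ⟨fun i j h => ⟨h.1.symm, by rw [sup_comm]; exact h.2⟩⟩
  loopless := ⟨fun i h => h.1 rfl⟩

/-- The 1-factorization `M_1, …, M_n` is `k`-semi-perfect: `M_i ∪ M_j` is a Hamilton cycle
whenever `i ≤ k < j` (labels are shifted by one, since `Fin n` starts at `0`). -/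
def OneFactorization.IsSemiPerfect {V : Type*} [DecidableEq V] {G : SimpleGraph V} {n : ℕ}
    (M : OneFactorization G (Fin n)) (k : ℕ) : Prop :=
  ∀ i j : Fin n, (i : ℕ) < k → k ≤ (j : ℕ) →
    IsHamiltonCycleSubgraph (M.factor i ⊔ M.factor j)

/-! The union of two disjoint perfect matchings is 2-regular, so it is a Hamilton cycle exactly when
it is connected; `Interlaced` expresses this connectivity. Only the Hamilton pairs across the two
classes need to be constructed. In a bipartite graph with an even number of vertices on each side,
three disjoint perfect matchings cannot form Hamilton cycles pairwise, by a sign argument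
(`not_pairwise_interlaced`), and a Hamilton pair inside one class would give such a triple.

The main tool is a pair of twins: two perfect colourings of `Q_n` in which the two matchings of each
colour together form a Hamilton cycle. Given twins of `Q_k` and of `Q_l`, view `Q_{k+l}` as `Q_k □
Q_l`. Let the rows alternate between the twins of `Q_k` by parity, colour all columns by one twin of
`Q_l`, and a single column by the other. A pair of rows matched by a column colour then carries a
Hamilton cycle of `Q_k` spread over two levels and cut open at one point; a parity count shows that
it stays connected (`Interlaced.rel_of_cut_vertex`), and the deviating column joins the pairs of
rows to each other (`interlaced_rows_columns`).

Twins of `Q_n` for `n ≥ 4` arise by induction in steps of four from tables for `n = 4, 5, 6, 7`; the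
induction also carries two Hamilton pairs inside each colouring. In `Q_4 □ Q_b` the row colours of
one twin face four column colours of the other. Every remaining colour would stay inside single
columns, so for each of them the copy of `Q_5` above one edge is recoloured by a gadget that links
the columns and keeps the row colours connected (`GadgetPlacement.interlaced_rest`,
`GadgetPlacement.interlaced_row`).

No twins of `Q_3` are used. For `k = 3` and `l ≥ 2`, pairs of rows of `Q_3 □ Q_l` split into three
strands running between three special columns; one exceptional pair permutes the strands
differently, and twins of `Q_l` close everything into one cycle. The case `(3, 1)` is a table. -/

/-- A perfect edge colouring of `G` with colours in `C`: the edges of each colour form a perfect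
matching, described by the involution sending a vertex to its mate in that colour. -/
structure PerfectColoring {V : Type*} (G : SimpleGraph V) (C : Type*) where
  mate : C → V → V
  mate_mate : ∀ c x, mate c (mate c x) = x
  adj_mate : ∀ c x, G.Adj x (mate c x)
  exists_mate_eq : ∀ x y, G.Adj x y → ∃ c, mate c x = y
  mate_inj : ∀ x c d, mate c x = mate d x → c = d

/-! ### Alternating cycles and parity arguments. -/

/-- Two maps are interlaced when their steps connect all points. For the mate functions of
two perfect matchings this says that their union is a Hamilton cycle. -/
def Interlaced {V : Type*} (f g : V → V) : Prop :=
  ∀ r : Setoid V, (∀ x, r x (f x)) → (∀ x, r x (g x)) → ∀ x y, r x y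

namespace Interlaced

variable {V W : Type*} {f g : V → V}

theorem symm (h : Interlaced f g) : Interlaced g f := fun r hg hf => h r hf hg

theorem comap_rel (h : Interlaced f g) (r : Setoid W) (p : V → W)
    (hf : ∀ x, r (p x) (p (f x))) (hg : ∀ x, r (p x) (p (g x))) (x y : V) : r (p x) (p y) :=
  h (r.comap p) hf hg x y

theorem mem_of_invariant (h : Interlaced f g) (s : Set V) (hf : ∀ x, x ∈ s ↔ f x ∈ s)
    (hg : ∀ x, x ∈ s ↔ g x ∈ s) {x : V} (hx : x ∈ s) (y : V) : y ∈ s := by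
  have := h (Setoid.ker (fun x => x ∈ s)) (fun x => propext (hf x)) (fun x => propext (hg x)) x y
  exact (Setoid.ker_def.1 this) ▸ hx

theorem conj (h : Interlaced f g) (e : V ≃ W) :
    Interlaced (fun w => e (f (e.symm w))) (fun w => e (g (e.symm w))) := by
  intro r hf hg x y
  have := h.comap_rel r e (fun x => by simpa using hf (e x)) (fun x => by simpa using hg (e x))
    (e.symm x) (e.symm y)
  simpa using this

end Interlaced

theorem Finset.even_card_of_fixedPointFree {α : Type*} (s : Finset α) (f : α → α)
    (hs : ∀ x ∈ s, f x ∈ s) (hff : ∀ x, f (f x) = x) (hf : ∀ x, f x ≠ x) : Even s.card := by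
  have h : ∑ x ∈ s, (1 : ZMod 2) = 0 :=
    Finset.sum_involution (fun x _ => f x) (fun _ _ => by decide) (fun x _ _ => hf x)
      (fun x hx => hs x hx) (fun x _ => hff x)
  rw [Finset.sum_const, nsmul_eq_mul, mul_one] at h
  exact (ZMod.natCast_eq_zero_iff_even).1 h

/-- A cycle alternating between `f` and `g` stays connected when it is cut open at `x₀`. -/
theorem Interlaced.rel_of_cut_vertex {X W : Type*} [Finite X] {f g : X → X}
    (h : Interlaced f g) (hff : ∀ x, f (f x) = x) (hf : ∀ x, f x ≠ x)
    (hgg : ∀ x, g (g x) = x) (hg : ∀ x, g x ≠ x)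
    (r : Setoid W) (p q : X → W) (x₀ : X) (hp : ∀ x, r (p x) (p (f x)))
    (hq : ∀ x, r (q x) (q (g x))) (hpq : ∀ x, x ≠ x₀ → r (p x) (q x)) (x : X) :
    r (p x) (p x₀) ∧ r (q x) (p x₀) := by
  classical
  have := Fintype.ofFinite X
  let S : Finset X := Finset.univ.filter fun x => r (p x) (p x₀)
  let T : Finset X := Finset.univ.filter fun x => r (q x) (p x₀)
  have hS : Even S.card := S.even_card_of_fixedPointFree f
    (fun x hx => by
      simp only [S, Finset.mem_filter, Finset.mem_univ, true_and] at hx ⊢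
      exact r.trans (r.symm (hp x)) hx) hff hf
  have hT : Even T.card := T.even_card_of_fixedPointFree g
    (fun x hx => by
      simp only [T, Finset.mem_filter, Finset.mem_univ, true_and] at hx ⊢
      exact r.trans (r.symm (hq x)) hx) hgg hg
  -- The class of `p x₀` meets the `p`-copy in an `f`-closed set and the `q`-copy in a `g`-closed
  -- set, both of even size; without `h0` these sets would differ in `x₀` alone.
  have h0 : r (q x₀) (p x₀) := by
    by_contra h0
    have : S = insert x₀ T := by
      ext x
      simp only [S, T, Finset.mem_filter, Finset.mem_univ, true_and, Finset.mem_insert]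
      by_cases hx : x = x₀
      · simp [hx]
      · simp only [hx, false_or]
        exact ⟨fun h => r.trans (r.symm (hpq x hx)) h, fun h => r.trans (hpq x hx) h⟩
    rw [this, Finset.card_insert_of_notMem (by simp [T, h0])] at hS
    exact (Nat.not_even_iff_odd.2 hT.add_one) hS
  have hpq' : ∀ x, r (p x) (q x) := fun x => by
    by_cases hx : x = x₀
    · subst hx; exact r.symm h0
    · exact hpq x hx
  have h1 := h.comap_rel r p hp
    (fun x => r.trans (hpq' x) (r.trans (hq x) (r.symm (hpq' _)))) x x₀
  exact ⟨h1, r.trans (r.symm (hpq' x)) h1⟩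

/-- A cycle alternating between `f` and `g` stays connected when one of its edges is removed. -/
theorem Interlaced.rel_of_cut_edge {X W : Type*} [Finite X] {f g : X → X}
    (h : Interlaced f g) (hff : ∀ x, f (f x) = x) (hf : ∀ x, f x ≠ x)
    (hgg : ∀ x, g (g x) = x) (hg : ∀ x, g x ≠ x)
    (r : Setoid W) (p : X → W) (u : X) (hp : ∀ x, x ≠ u → x ≠ f u → r (p x) (p (f x)))
    (hq : ∀ x, r (p x) (p (g x))) (x y : X) : r (p x) (p y) := by
  classical
  have := Fintype.ofFinite X
  let S : Finset X := Finset.univ.filter fun x => r (p x) (p u)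
  have hS : Even S.card := S.even_card_of_fixedPointFree g
    (fun x hx => by
      simp only [S, Finset.mem_filter, Finset.mem_univ, true_and] at hx ⊢
      exact r.trans (r.symm (hq x)) hx) hgg hg
  -- The class of `p u` is closed under `g`. If it missed `f u`, removing `u` would leave a set
  -- closed under `f`, and both sizes would be even.
  have h0 : r (p (f u)) (p u) := by
    by_contra h0
    have hS' : Even (S.erase u).card := (S.erase u).even_card_of_fixedPointFree f
      (fun x hx => by
        simp only [S, Finset.mem_filter, Finset.mem_univ, true_and, Finset.mem_erase] at hx ⊢
        have hx' : x ≠ f u := by rintro rfl; exact h0 hx.2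
        refine ⟨fun hu => hx' (by rw [← hu, hff]), ?_⟩
        exact r.trans (r.symm (hp x hx.1 hx')) hx.2) hff hf
    have hu : u ∈ S := by simp [S]
    rw [← Finset.card_erase_add_one hu] at hS
    exact (Nat.not_even_iff_odd.2 hS'.add_one) hS
  refine h.comap_rel r p (fun x => ?_) hq x y
  by_cases hx : x = u
  · subst hx; exact r.symm h0
  by_cases hx' : x = f u
  · subst hx'; rw [hff]; exact h0
  exact hp x hx hx'

/-! ### Colourings of box products. -/

namespace PerfectColoring

variable {V W C D : Type*} {G : SimpleGraph V} {H : SimpleGraph W}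

theorem mate_ne (A : PerfectColoring G C) (c : C) (x : V) : A.mate c x ≠ x :=
  fun h => G.loopless.irrefl x (by simpa [h] using A.adj_mate c x)

/-- Transport along a graph isomorphism and a renaming of the colours. -/
def map (A : PerfectColoring G C) (e : G ≃g H) (k : D ≃ C) : PerfectColoring H D where
  mate d w := e (A.mate (k d) (e.symm w))
  mate_mate d w := by simp [A.mate_mate]
  adj_mate d w := by
    have := e.map_adj_iff.2 (A.adj_mate (k d) (e.symm w))
    simpa using this
  exists_mate_eq x y h := by
    obtain ⟨c, hc⟩ := A.exists_mate_eq (e.symm x) (e.symm y) (e.symm.map_adj_iff.2 h)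
    exact ⟨k.symm c, by simp [hc]⟩
  mate_inj x c d h := k.injective (A.mate_inj _ _ _ (e.injective h))

theorem interlaced_map {A B : PerfectColoring G C} {k k' : D ≃ C} {c d : D}
    (h : Interlaced (A.mate (k c)) (B.mate (k' d))) (e : G ≃g H) :
    Interlaced ((A.map e k).mate c) ((B.map e k').mate d) :=
  h.conj e.toEquiv

/-- Colour the rows `V × {y}` and the columns `{x} × W` of a box product independently. -/
def boxProd (R : W → PerfectColoring G C) (K : V → PerfectColoring H D) :
    PerfectColoring (G □ H) (C ⊕ D) where
  mate c z := match c with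
    | .inl c => ((R z.2).mate c z.1, z.2)
    | .inr d => (z.1, (K z.1).mate d z.2)
  mate_mate c z := by cases c <;> simp [mate_mate]
  adj_mate c z := by cases c <;> simp [adj_mate, SimpleGraph.boxProd_adj]
  exists_mate_eq x y h := by
    rw [SimpleGraph.boxProd_adj] at h
    obtain ⟨h, h'⟩ | ⟨h, h'⟩ := h
    · obtain ⟨c, hc⟩ := (R x.2).exists_mate_eq _ _ h
      exact ⟨.inl c, Prod.ext hc h'⟩
    · obtain ⟨c, hc⟩ := (K x.1).exists_mate_eq _ _ h
      exact ⟨.inr c, Prod.ext h' hc⟩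
  mate_inj x c d h := by
    cases c <;> cases d <;> simp only [Prod.mk.injEq] at h
    · rw [(R x.2).mate_inj _ _ _ h.1]
    · exact absurd h.1 (mate_ne _ _ _)
    · exact absurd h.1.symm (mate_ne _ _ _)
    · rw [(K x.1).mate_inj _ _ _ h.2]

end PerfectColoring

/-- If the rows alternate between `g₀` and `g₁`, and the columns use `F` except for one which
uses `F'`, then the row steps and the column steps connect everything. -/
theorem interlaced_rows_columns {X V : Type*} [Finite X] {g₀ g₁ : X → X} {F F' : V → V}
    (hg : Interlaced g₀ g₁) (h₀ : ∀ x, g₀ (g₀ x) = x) (h₀' : ∀ x, g₀ x ≠ x)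
    (h₁ : ∀ x, g₁ (g₁ x) = x) (h₁' : ∀ x, g₁ x ≠ x) (hF : Interlaced F F')
    (par : V → Bool) (hpar : ∀ y, par (F y) = !par y) (x₀ : X)
    (a b : X × V → X × V) (ha₀ : ∀ x y, par y = false → a (x, y) = (g₀ x, y))
    (ha₁ : ∀ x y, par y = true → a (x, y) = (g₁ x, y))
    (hb : ∀ x y, x ≠ x₀ → b (x, y) = (x, F y)) (hb₀ : ∀ y, b (x₀, y) = (x₀, F' y)) :
    Interlaced a b := by
  intro r hra hrb
  -- The rows `y` and `F y` carry different ones of `g₀`, `g₁` and have rungs at every `x ≠ x₀`: the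
  -- alternating cycle is spread over two rows and cut at `x₀`.
  have key : ∀ x y, r (x, y) (x₀, y) ∧ r (x, F y) (x₀, y) := by
    intro x y
    have hpq : ∀ x, x ≠ x₀ → r (x, y) (x, F y) := fun x hx => by
      rw [← hb x y hx]; exact hrb _
    cases hy : par y
    · have hy' : par (F y) = true := by rw [hpar, hy]; rfl
      exact hg.rel_of_cut_vertex h₀ h₀' h₁ h₁' r (fun x => (x, y)) (fun x => (x, F y)) x₀
        (fun x => by rw [← ha₀ x y hy]; exact hra _)
        (fun x => by rw [← ha₁ x _ hy']; exact hra _) hpq x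
    · have hy' : par (F y) = false := by rw [hpar, hy]; rfl
      exact hg.symm.rel_of_cut_vertex h₁ h₁' h₀ h₀' r (fun x => (x, y)) (fun x => (x, F y)) x₀
        (fun x => by rw [← ha₁ x y hy]; exact hra _)
        (fun x => by rw [← ha₀ x _ hy']; exact hra _) hpq x
  have col := hF.comap_rel r (fun y => (x₀, y)) (fun y => r.symm (key x₀ y).2)
    (fun y => by rw [← hb₀ y]; exact hrb _)
  rintro ⟨x, y⟩ ⟨x', y'⟩
  exact r.trans (key x y).1 (r.trans (col y y') (r.symm (key x' y').1))

/-! ### The bipartition of the hypercube. -/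

theorem hypercube_adj_iff {d : ℕ} {s t : Finset (Fin d)} :
    (hypercube d).Adj s t ↔ ∃ i, t = symmDiff s {i} := by
  change (symmDiff s t).card = 1 ↔ _
  rw [Finset.card_eq_one]
  refine exists_congr fun i => ⟨fun h => ?_, fun h => ?_⟩
  · rw [← h, symmDiff_symmDiff_cancel_left]
  · rw [h, symmDiff_symmDiff_cancel_left]

/-- The bipartition of the hypercube. -/
def hypercubeParity {d : ℕ} (s : Finset (Fin d)) : Bool := decide (Odd s.card)

theorem hypercubeParity_symmDiff_singleton {d : ℕ} (s : Finset (Fin d)) (i : Fin d) :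
    hypercubeParity (symmDiff s {i}) = !hypercubeParity s := by
  unfold hypercubeParity
  by_cases hi : i ∈ s
  · have h : symmDiff s {i} = s.erase i := by
      ext j; simp only [Finset.mem_symmDiff, Finset.mem_singleton, Finset.mem_erase]
      by_cases hj : j = i <;> simp_all
    rw [h, ← Finset.card_erase_add_one hi]
    by_cases ho : Odd (s.erase i).card <;> simp [Nat.odd_add_one, ho]
  · have h : symmDiff s {i} = insert i s := by
      ext j; simp only [Finset.mem_symmDiff, Finset.mem_singleton, Finset.mem_insert]
      by_cases hj : j = i <;> simp_all
    rw [h, Finset.card_insert_of_notMem hi]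
    by_cases ho : Odd s.card <;> simp [Nat.odd_add_one, ho]

theorem hypercubeParity_of_adj {d : ℕ} {s t : Finset (Fin d)} (h : (hypercube d).Adj s t) :
    hypercubeParity t = !hypercubeParity s := by
  obtain ⟨i, rfl⟩ := hypercube_adj_iff.1 h
  exact hypercubeParity_symmDiff_singleton s i

/-- Toggling two fixed elements is an involution without fixed points that preserves parity. -/
theorem even_card_hypercubeParity {d : ℕ} (hd : 2 ≤ d) :
    Even (Finset.univ.filter fun s : Finset (Fin d) => hypercubeParity s = false).card := by
  let i : Fin d := ⟨0, by omega⟩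
  let j : Fin d := ⟨1, by omega⟩
  have hij : i ≠ j := by simp [i, j]
  refine Finset.even_card_of_fixedPointFree _ (fun s => symmDiff (symmDiff s {i}) {j}) ?_ ?_ ?_
  · intro s hs
    simpa [hypercubeParity_symmDiff_singleton] using hs
  · intro s
    rw [symmDiff_assoc, symmDiff_symmDiff_symmDiff_comm]
    simp
  · intro s hs
    rw [symmDiff_assoc, symmDiff_eq_left] at hs
    have : i ∈ symmDiff ({i} : Finset (Fin d)) {j} := by simp [Finset.mem_symmDiff, hij]
    rw [hs] at this
    simp at this

/-! ### No three matchings form Hamilton cycles pairwise. -/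

section Sign

variable {V : Type*} {par : V → Bool} {f g h : V → V}

/-- The permutation `g ∘ f` of the even vertices. -/
def evenPerm (par : V → Bool) (f g : V → V) (hff : ∀ x, f (f x) = x) (hgg : ∀ x, g (g x) = x)
    (hf : ∀ x, par (f x) = !par x) (hg : ∀ x, par (g x) = !par x) :
    Equiv.Perm {x // par x = false} where
  toFun x := ⟨g (f x), by simp [hf, hg, x.2]⟩
  invFun x := ⟨f (g x), by simp [hf, hg, x.2]⟩
  left_inv x := by simp [hff, hgg]
  right_inv x := by simp [hff, hgg]

/-- Taking every second vertex of the Hamilton cycle shows that `g ∘ f` is a single cycle on all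
even vertices; a cycle of even length is an odd permutation. -/
theorem Interlaced.sign_evenPerm [Fintype V] [DecidableEq V] (H : Interlaced f g)
    (hff : ∀ x, f (f x) = x) (hgg : ∀ x, g (g x) = x)
    (hf : ∀ x, par (f x) = !par x) (hg : ∀ x, par (g x) = !par x) (hfg : ∀ x, f x ≠ g x)
    (hE : Even (Finset.univ.filter fun x => par x = false).card) [Nonempty {x // par x = false}] :
    Equiv.Perm.sign (evenPerm par f g hff hgg hf hg) = -1 := by
  set π := evenPerm par f g hff hgg hf hg with hπ
  -- An odd vertex is represented by its `f`-mate, so `f`-steps do not change the representative and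
  -- `g`-steps move it along the cycle.
  let rep : V → {x // par x = false} := fun x =>
    if hx : par x = false then ⟨x, hx⟩ else ⟨f x, by simpa [hf] using hx⟩
  have same : ∀ x y, π.SameCycle x y := by
    intro x y
    have := H ((Equiv.Perm.SameCycle.setoid π).comap rep) (fun z => ?_) (fun z => ?_) x y
    · simp only [Setoid.comap_rel, rep, x.2, y.2, dite_true] at this
      exact this
    · have : rep (f z) = rep z := by
        by_cases hz : par z = false <;> simp [rep, hz, hf, hff]
      change π.SameCycle (rep z) (rep (f z))
      rw [this]
    · change π.SameCycle (rep z) (rep (g z))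
      by_cases hz : par z = false
      · have : π (rep (g z)) = rep z := by
          apply Subtype.ext; simp [rep, hz, hg, π, evenPerm, hff, hgg]
        rw [← this]
        exact (Equiv.Perm.sameCycle_apply_left).2 (Equiv.Perm.SameCycle.refl _ _)
      · have : π (rep z) = rep (g z) := by
          apply Subtype.ext; simp [rep, hz, hg, π, evenPerm, hff]
        rw [← this]
        exact (Equiv.Perm.sameCycle_apply_right).2 (Equiv.Perm.SameCycle.refl _ _)
  have hne : ∀ x, π x ≠ x := fun x hx => by
    have h1 : g (f x) = x := congrArg Subtype.val hx
    exact hfg x (by rw [← hgg (f x), h1])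
  have hcyc : π.IsCycle :=
    ⟨Classical.arbitrary _, hne _, fun y _ => same _ y⟩
  rw [hcyc.sign]
  have hsupp : π.support = Finset.univ := by
    ext x; simp [hne x]
  rw [hsupp, Finset.card_univ, Fintype.card_subtype, hE.neg_one_pow]

/-- Three perfect matchings of a bipartite graph whose order is divisible by four cannot form
Hamilton cycles pairwise. -/
theorem not_pairwise_interlaced [Fintype V] [DecidableEq V]
    (hff : ∀ x, f (f x) = x) (hgg : ∀ x, g (g x) = x) (hhh : ∀ x, h (h x) = x)
    (hf : ∀ x, par (f x) = !par x) (hg : ∀ x, par (g x) = !par x) (hh : ∀ x, par (h x) = !par x)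
    (hfg : ∀ x, f x ≠ g x) (hgh : ∀ x, g x ≠ h x) (hhf : ∀ x, h x ≠ f x)
    (hE : Even (Finset.univ.filter fun x => par x = false).card) [Nonempty {x // par x = false}]
    (H₁ : Interlaced f g) (H₂ : Interlaced g h) (H₃ : Interlaced h f) : False := by
  have h₁ := H₁.sign_evenPerm hff hgg hf hg hfg hE
  have h₂ := H₂.sign_evenPerm hgg hhh hg hh hgh hE
  have h₃ := H₃.sign_evenPerm hhh hff hh hf hhf hE
  -- The product telescopes to the identity, although it is a product of three odd permutations.
  have : evenPerm par h f hhh hff hh hf * evenPerm par g h hgg hhh hg hh *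
      evenPerm par f g hff hgg hf hg = 1 := by
    ext x
    simp [evenPerm, hff, hgg, hhh]
  have := congrArg Equiv.Perm.sign this
  rw [map_mul, map_mul, h₁, h₂, h₃, map_one] at this
  exact absurd this (by decide)

end Sign

/-! ### From colourings to 1-factorizations. -/

namespace PerfectColoring

variable {V C : Type*} {G : SimpleGraph V} (A : PerfectColoring G C)

/-- The perfect matching formed by the edges of one colour. -/
def factor (c : C) : G.Subgraph where
  verts := Set.univ
  Adj x y := A.mate c x = y
  adj_sub := by rintro x y rfl; exact A.adj_mate c x
  edge_vert _ := Set.mem_univ _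
  symm := ⟨by rintro x y rfl; exact A.mate_mate c x⟩

/-- The 1-factorization given by a perfect edge colouring. -/
def toOneFactorization : OneFactorization G C where
  factor := A.factor
  isPerfectMatching c :=
    ⟨fun x _ => ⟨A.mate c x, rfl, fun _ h => Eq.symm h⟩, fun x => Set.mem_univ x⟩
  existsUnique_factor e he := by
    induction e using Sym2.ind with
    | _ x y =>
      obtain ⟨c, hc⟩ := A.exists_mate_eq x y he
      exact ⟨c, hc, fun d (hd : A.mate d x = y) => A.mate_inj x d c (hd.trans hc.symm)⟩

/-- Each component of the 2-regular union is a cycle, and interlacing leaves only one component. -/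
theorem isHamiltonCycleSubgraph_of_interlaced [Finite V] [Nonempty V] [DecidableEq V] {c d : C}
    (hcd : c ≠ d) (h : Interlaced (A.mate c) (A.mate d)) :
    IsHamiltonCycleSubgraph (A.factor c ⊔ A.factor d) := by
  let G' : SimpleGraph V := (A.factor c ⊔ A.factor d).spanningCoe
  have hadj : ∀ x y, G'.Adj x y ↔ A.mate c x = y ∨ A.mate d x = y := fun x y => Iff.rfl
  have hle : G' ≤ G := fun x y hxy => (A.factor c ⊔ A.factor d).adj_sub hxy
  have hnbr : ∀ x, (G'.neighborSet x).ncard = 2 := fun x => by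
    have : G'.neighborSet x = {A.mate c x, A.mate d x} := by
      ext y; simp [SimpleGraph.mem_neighborSet, hadj, eq_comm]
    rw [this, Set.ncard_pair (fun h => hcd (A.mate_inj x c d h))]
  have hcyc : G'.IsCycles := fun x _ => hnbr x
  have hreach : ∀ x y, G'.Reachable x y :=
    h G'.reachableSetoid (fun x => SimpleGraph.Adj.reachable ((hadj _ _).2 (.inl rfl)))
      (fun x => SimpleGraph.Adj.reachable ((hadj _ _).2 (.inr rfl)))
  let v : V := Classical.arbitrary V
  obtain ⟨p, hp, hverts⟩ := hcyc.exists_cycle_toSubgraph_verts_eq_connectedComponentSupp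
    (c := G'.connectedComponentMk v) (v := v) rfl ⟨A.mate c v, (hadj _ _).2 (.inl rfl)⟩
  have hsupp : ∀ w, w ∈ p.support := fun w => by
    rw [← SimpleGraph.Walk.mem_verts_toSubgraph, hverts]
    exact SimpleGraph.ConnectedComponent.eq.2 (hreach w v)
  have hpadj : ∀ x y, p.toSubgraph.Adj x y ↔ G'.Adj x y := fun x y => by
    refine ⟨fun h => p.toSubgraph.adj_sub h, fun h => ?_⟩
    have : p.toSubgraph.neighborSet x = G'.neighborSet x := by
      refine Set.eq_of_subset_of_ncard_le (fun y hy => p.toSubgraph.adj_sub hy) ?_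
        (Set.toFinite _)
      rw [hnbr, hp.ncard_neighborSet_toSubgraph_eq_two (hsupp x)]
    have hy : y ∈ G'.neighborSet x := h
    rw [← this] at hy
    exact hy
  refine ⟨v, p.mapLe hle, ?_, ?_⟩
  · refine SimpleGraph.Walk.IsHamiltonianCycle.map (f := SimpleGraph.Hom.ofLE hle)
      Function.bijective_id ⟨hp, hp.isPath_tail.isHamiltonian_of_mem fun w => ?_⟩
    have hw := hsupp w
    rw [← SimpleGraph.Walk.cons_support_tail hp.not_nil, List.mem_cons] at hw
    rcases hw with rfl | hw
    · exact SimpleGraph.Walk.end_mem_support _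
    · exact hw
  · refine SimpleGraph.Subgraph.ext ?_ ?_
    · ext w
      simp only [SimpleGraph.Walk.mem_verts_toSubgraph, SimpleGraph.Walk.support_mapLe_eq_support]
      exact ⟨fun _ => Or.inl trivial, fun _ => hsupp w⟩
    · ext x y
      rw [SimpleGraph.Walk.adj_toSubgraph_mapLe]
      exact hpadj x y

theorem interlaced_of_isHamiltonCycleSubgraph [DecidableEq V] {c d : C}
    (h : IsHamiltonCycleSubgraph (A.factor c ⊔ A.factor d)) :
    Interlaced (A.mate c) (A.mate d) := by
  obtain ⟨v, p, -, hp⟩ := h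
  intro r hc hd x y
  have hconn := p.toSubgraph_connected
  rw [hp] at hconn
  obtain ⟨q⟩ := hconn.preconnected ⟨x, Or.inl trivial⟩ ⟨y, Or.inl trivial⟩
  have : ∀ {a b} (q : (A.factor c ⊔ A.factor d).coe.Walk a b), r a.1 b.1 := by
    intro a b q
    induction q with
    | nil => exact r.refl _
    | cons hab _ ih =>
      refine r.trans ?_ ih
      rcases hab with hab | hab
      · exact hab ▸ hc _
      · exact hab ▸ hd _
  exact this q

/-- A perfect colouring of the hypercube with `k` colours each forming Hamilton cycles with
`l` other colours yields the required 1-factorization. -/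
theorem exists_isSemiPerfect {k l : ℕ} (hk : 1 ≤ k) (hl : 1 ≤ l)
    (A : PerfectColoring (hypercube (k + l)) (Fin k ⊕ Fin l))
    (hA : ∀ i j, Interlaced (A.mate (.inl i)) (A.mate (.inr j))) :
    ∃ M : OneFactorization (hypercube (k + l)) (Fin (k + l)),
      Nonempty (M.hamiltonPairGraph ≃g completeBipartiteGraph (Fin k) (Fin l)) ∧
      M.IsSemiPerfect k := by
  have hE := even_card_hypercubeParity (d := k + l) (by omega)
  have : Nonempty {s : Finset (Fin (k + l)) // hypercubeParity s = false} :=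
    ⟨∅, by simp [hypercubeParity]⟩
  have hpar : ∀ c s, hypercubeParity (A.mate c s) = !hypercubeParity s :=
    fun c s => hypercubeParity_of_adj (A.adj_mate c s)
  have tri : ∀ a b c, a ≠ b → b ≠ c → c ≠ a → Interlaced (A.mate a) (A.mate b) →
      Interlaced (A.mate b) (A.mate c) → ¬ Interlaced (A.mate c) (A.mate a) :=
    fun a b c hab hbc hca h₁ h₂ h₃ => not_pairwise_interlaced (A.mate_mate a) (A.mate_mate b)
      (A.mate_mate c) (hpar a) (hpar b) (hpar c) (fun x hx => hab (A.mate_inj x _ _ hx))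
      (fun x hx => hbc (A.mate_inj x _ _ hx)) (fun x hx => hca (A.mate_inj x _ _ hx))
      hE h₁ h₂ h₃
  have key : ∀ a b, (a ≠ b ∧ IsHamiltonCycleSubgraph (A.factor a ⊔ A.factor b)) ↔
      (completeBipartiteGraph (Fin k) (Fin l)).Adj a b := by
    have iff : ∀ a b, (a ≠ b ∧ IsHamiltonCycleSubgraph (A.factor a ⊔ A.factor b)) ↔
        (a ≠ b ∧ Interlaced (A.mate a) (A.mate b)) := fun a b =>
      and_congr_right fun h => ⟨A.interlaced_of_isHamiltonCycleSubgraph,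
        A.isHamiltonCycleSubgraph_of_interlaced h⟩
    intro a b
    rw [iff]
    rcases a with a | a <;> rcases b with b | b
    · simp only [completeBipartiteGraph_adj, Sum.isLeft_inl, Sum.isRight_inl, Bool.false_eq_true,
        and_false, false_and, or_false, iff_false, not_and]
      intro hab h
      -- Any colour of the other class completes the pair to a forbidden triple.
      exact tri (.inl a) (.inl b) (.inr ⟨0, hl⟩) hab (by simp) (by simp) h (hA _ _) (hA _ _).symm
    · simp [hA]
    · simpa using (hA b a).symm
    · simp only [completeBipartiteGraph_adj, Sum.isLeft_inr, Sum.isRight_inr, Bool.false_eq_true,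
        and_false, false_and, or_false, iff_false, not_and]
      intro hab h
      exact tri (.inr a) (.inr b) (.inl ⟨0, hk⟩) hab (by simp) (by simp) h (hA _ _).symm (hA _ _)
  let e : Fin (k + l) ≃ Fin k ⊕ Fin l := finSumFinEquiv.symm
  refine ⟨(A.map .refl e).toOneFactorization, ⟨⟨e, ?_⟩⟩, ?_⟩
  · intro i j
    rw [← key, e.injective.ne_iff]
    rfl
  · intro i j hi hj
    have : (completeBipartiteGraph (Fin k) (Fin l)).Adj (e i) (e j) := by
      obtain ⟨i', rfl⟩ : ∃ i' : Fin k, i = Fin.castAdd l i' := ⟨⟨i, hi⟩, rfl⟩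
      obtain ⟨j', rfl⟩ : ∃ j' : Fin l, j = Fin.natAdd k j' :=
        ⟨⟨j - k, by omega⟩, Fin.ext (by simp; omega)⟩
      simp [e]
    exact ((key _ _).2 this).2

end PerfectColoring

/-! ### Numerically coded cubes and tables. -/

/-- The hypercube with vertices coded as numbers by their binary digits. -/
def cubeGraph (n : ℕ) : SimpleGraph (Fin (2 ^ n)) where
  Adj x y := ∃ d < n, y.val = x.val ^^^ 2 ^ d
  symm := ⟨fun x y ⟨d, hd, h⟩ => ⟨d, hd, by rw [h, Nat.xor_assoc, Nat.xor_self, Nat.xor_zero]⟩⟩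
  loopless := ⟨fun x ⟨d, _, h⟩ => by
    have h' := congrArg (Nat.testBit · d) h
    simp only [Nat.testBit_xor, Nat.testBit_two_pow_self] at h'
    cases hx : x.val.testBit d <;> simp [hx] at h'⟩

theorem cubeGraph_adj {n : ℕ} {x y : Fin (2 ^ n)} :
    (cubeGraph n).Adj x y ↔ ∃ d < n, y.val = x.val ^^^ 2 ^ d := Iff.rfl

/-- Reading off the set of binary digits. -/
def bitSet (n : ℕ) (x : Fin (2 ^ n)) : Finset (Fin n) :=
  Finset.univ.filter fun i => x.val.testBit i = true

theorem bitSet_injective (n : ℕ) : Function.Injective (bitSet n) := by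
  intro x y h
  refine Fin.ext (Nat.eq_of_testBit_eq fun i => ?_)
  by_cases hi : i < n
  · have : (⟨i, hi⟩ : Fin n) ∈ bitSet n x ↔ ⟨i, hi⟩ ∈ bitSet n y := by rw [h]
    rw [Bool.eq_iff_iff]
    simpa only [bitSet, Finset.mem_filter, Finset.mem_univ, true_and] using this
  · have hle : 2 ^ n ≤ 2 ^ i := Nat.pow_le_pow_right (by norm_num) (by omega)
    rw [Nat.testBit_lt_two_pow (x.2.trans_le hle), Nat.testBit_lt_two_pow (y.2.trans_le hle)]

theorem bitSet_bijective (n : ℕ) : Function.Bijective (bitSet n) :=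
  (Fintype.bijective_iff_injective_and_card _).2 ⟨bitSet_injective n, by simp⟩

/-- The numerical hypercube is the hypercube. -/
noncomputable def cubeIso (n : ℕ) : cubeGraph n ≃g hypercube n where
  toEquiv := Equiv.ofBijective _ (bitSet_bijective n)
  map_rel_iff' := by
    intro x y
    rw [cubeGraph_adj, hypercube_adj_iff]
    constructor
    · rintro ⟨i, hi⟩
      have hi : bitSet n y = symmDiff (bitSet n x) {i} := hi
      refine ⟨i, i.2, Nat.eq_of_testBit_eq fun j => ?_⟩
      rw [Nat.testBit_xor, Nat.testBit_two_pow]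
      by_cases hj : j < n
      · have : (⟨j, hj⟩ : Fin n) ∈ bitSet n y ↔ (⟨j, hj⟩ : Fin n) ∈ symmDiff (bitSet n x) {i} := by
          rw [← hi]
        simp only [bitSet, Finset.mem_filter, Finset.mem_univ, true_and, Finset.mem_symmDiff,
          Finset.mem_singleton, Fin.ext_iff] at this
        by_cases h1 : (i : ℕ) = j
        · subst h1
          cases hx : x.val.testBit i <;> cases hy : y.val.testBit i <;> simp_all
        · have h2 : ¬ j = (i : ℕ) := fun h => h1 h.symm
          cases hx : x.val.testBit j <;> cases hy : y.val.testBit j <;> simp_all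
      · have hle : 2 ^ n ≤ 2 ^ j := Nat.pow_le_pow_right (by norm_num) (by omega)
        rw [Nat.testBit_lt_two_pow (x.2.trans_le hle), Nat.testBit_lt_two_pow (y.2.trans_le hle)]
        have : (i : ℕ) ≠ j := by have := i.2; omega
        simp [this]
    · rintro ⟨d, hd, h⟩
      refine ⟨⟨d, hd⟩, ?_⟩
      ext j
      change j ∈ bitSet n y ↔ j ∈ symmDiff (bitSet n x) {⟨d, hd⟩}
      simp only [bitSet, Finset.mem_filter, Finset.mem_univ, true_and, Finset.mem_symmDiff,
          Finset.mem_singleton, Fin.ext_iff, h, Nat.testBit_xor, Nat.testBit_two_pow]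
      by_cases h1 : (j : ℕ) = d
      · cases hx : x.val.testBit j <;> simp [h1]
      · have h2 : ¬ d = (j : ℕ) := fun h => h1 h.symm
        cases hx : x.val.testBit j <;> simp [h1, h2]

/-- The box product of hypercubes is a hypercube. -/
def hypercubeBoxProdIso (a b : ℕ) : (hypercube a).boxProd (hypercube b) ≃g hypercube (a + b) where
  toEquiv := Finset.sumEquiv.symm.toEquiv.trans finSumFinEquiv.finsetCongr
  map_rel_iff' := by
    rintro ⟨s, t⟩ ⟨s', t'⟩
    change (symmDiff ((s.disjSum t).map _) ((s'.disjSum t').map _)).card = 1 ↔ _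
    have h : symmDiff (s.disjSum t) (s'.disjSum t') =
        (symmDiff s s').disjSum (symmDiff t t') := by
      ext (x | x) <;> simp [Finset.mem_symmDiff]
    have hmap : ∀ u v : Finset (Fin a ⊕ Fin b), symmDiff (u.map finSumFinEquiv.toEmbedding)
        (v.map finSumFinEquiv.toEmbedding) = (symmDiff u v).map finSumFinEquiv.toEmbedding :=
      fun u v => by
        rw [symmDiff_def, symmDiff_def, Finset.sup_eq_union, Finset.sup_eq_union,
          Finset.map_union, Finset.map_sdiff, Finset.map_sdiff]
    rw [hmap, Finset.card_map, h, Finset.card_disjSum, SimpleGraph.boxProd_adj]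
    change _ ↔ ((symmDiff s s').card = 1 ∧ t = t') ∨ ((symmDiff t t').card = 1 ∧ s = s')
    have hs : (symmDiff s s').card = 0 ↔ s = s' := by
      rw [Finset.card_eq_zero, ← Finset.bot_eq_empty, symmDiff_eq_bot]
    have ht : (symmDiff t t').card = 0 ↔ t = t' := by
      rw [Finset.card_eq_zero, ← Finset.bot_eq_empty, symmDiff_eq_bot]
    rw [← hs, ← ht]
    omega

/-- Entry `x` in row `c` of a table of hexadecimal digits. -/
def tableDir (T : List ℕ) (c x : ℕ) : ℕ := (T.getD c 0 >>> (4 * x)) % 16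

/-- The neighbour of `x` in the direction given by a table. -/
def tableMate (T : List ℕ) (c x : ℕ) : ℕ := x ^^^ 2 ^ tableDir T c x

/-- The table describes a perfect colouring of the `n`-cube with `n` colours. -/
def validTable (T : List ℕ) (n : ℕ) : Bool :=
  (List.range (2 ^ n)).all fun x => (List.range n).all fun c =>
    decide (tableDir T c x < n) && (tableDir T c (tableMate T c x) == tableDir T c x) &&
    (List.range c).all fun c' => tableDir T c' x != tableDir T c x

section ValidTable

variable {T : List ℕ} {n : ℕ} (hT : validTable T n = true)
include hT

theorem validTable.spec (x c : ℕ) (hx : x < 2 ^ n) (hc : c < n) :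
    tableDir T c x < n ∧ tableDir T c (tableMate T c x) = tableDir T c x ∧
      ∀ c' < c, tableDir T c' x ≠ tableDir T c x := by
  simp only [validTable, List.all_eq_true, List.mem_range, Bool.and_eq_true, decide_eq_true_eq,
    beq_iff_eq, bne_iff_ne] at hT
  exact ⟨(hT x hx c hc).1.1, (hT x hx c hc).1.2, (hT x hx c hc).2⟩

theorem validTable.mate_lt (x c : ℕ) (hx : x < 2 ^ n) (hc : c < n) : tableMate T c x < 2 ^ n :=
  Nat.xor_lt_two_pow hx (Nat.pow_lt_pow_right (by norm_num) (validTable.spec hT x c hx hc).1)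

theorem validTable.dir_inj (x : ℕ) (hx : x < 2 ^ n) (c d : Fin n)
    (h : tableDir T c x = tableDir T d x) : c = d := by
  rcases lt_trichotomy c d with hcd | hcd | hcd
  · exact absurd h ((validTable.spec hT x d hx d.2).2.2 c hcd)
  · exact hcd
  · exact absurd h.symm ((validTable.spec hT x c hx c.2).2.2 d hcd)

end ValidTable

/-- The perfect colouring described by a valid table. -/
def tableColoring (T : List ℕ) (n : ℕ) (hT : validTable T n = true) :
    PerfectColoring (cubeGraph n) (Fin n) where
  mate c x := ⟨tableMate T c x, validTable.mate_lt hT x c x.2 c.2⟩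
  mate_mate c x := by
    apply Fin.ext
    change tableMate T c (tableMate T c x) = x
    conv_lhs => rw [tableMate, (validTable.spec hT x c x.2 c.2).2.1, tableMate]
    rw [Nat.xor_assoc, Nat.xor_self, Nat.xor_zero]
  adj_mate c x := ⟨_, (validTable.spec hT x c x.2 c.2).1, rfl⟩
  exists_mate_eq := by
    rintro x y ⟨d, hd, hy⟩
    have hinj : Function.Injective fun c : Fin n =>
        (⟨tableDir T c x, (validTable.spec hT x c x.2 c.2).1⟩ : Fin n) := fun c c' h =>
      validTable.dir_inj hT x x.2 c c' (congrArg Fin.val h)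
    obtain ⟨c, hc⟩ := (Finite.injective_iff_surjective.1 hinj) ⟨d, hd⟩
    have hc : tableDir T c x = d := congrArg Fin.val hc
    exact ⟨c, Fin.ext (by rw [hy, ← hc]; rfl)⟩
  mate_inj x c d h := by
    refine validTable.dir_inj hT x x.2 c d (Nat.pow_right_injective le_rfl ?_)
    have h : x.val ^^^ 2 ^ tableDir T c x = x.val ^^^ 2 ^ tableDir T d x := congrArg Fin.val h
    have h' := congrArg (x.val ^^^ ·) h
    simpa [← Nat.xor_assoc] using h'

/-- The set of points visited from `x` by `k` rounds of `f` followed by `g`, as a bit mask. -/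
def orbitMask (f g : ℕ → ℕ) : ℕ → ℕ → ℕ
  | 0, _ => 0
  | k + 1, x => (2 ^ x ||| 2 ^ f x) ||| orbitMask f g k (g (f x))

theorem of_testBit_orbitMask {f g : ℕ → ℕ} {P : ℕ → Prop} (hf : ∀ x, P x → P (f x))
    (hg : ∀ x, P x → P (g x)) (k x : ℕ) (hx : P x) (y : ℕ)
    (hy : (orbitMask f g k x).testBit y = true) : P y := by
  induction k generalizing x with
  | zero => simp [orbitMask] at hy
  | succ k ih =>
    rw [orbitMask, Nat.testBit_or, Nat.testBit_or, Nat.testBit_two_pow, Nat.testBit_two_pow,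
      Bool.or_eq_true, Bool.or_eq_true, decide_eq_true_eq, decide_eq_true_eq] at hy
    rcases hy with (rfl | rfl) | hy
    · exact hx
    · exact hf _ hx
    · exact ih _ (hg _ (hf _ hx)) hy

/-- Every point whose bit is set in the mask is joined to `0`, and a mask of `2 ^ n` ones omits no
point. A Hamilton cycle is exhausted by `2 ^ (n - 1)` rounds of two steps. -/
theorem tableColoring_interlaced {T T' : List ℕ} {n : ℕ} (hT : validTable T n = true)
    (hT' : validTable T' n = true) (c d : Fin n)
    (h : orbitMask (tableMate T c) (tableMate T' d) (2 ^ (n - 1)) 0 = 2 ^ 2 ^ n - 1) :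
    Interlaced ((tableColoring T n hT).mate c) ((tableColoring T' n hT').mate d) := by
  intro r hf hg
  have h0 : ∀ y : Fin (2 ^ n), r ⟨0, Nat.two_pow_pos n⟩ y := fun y => by
    obtain ⟨_, hy⟩ := of_testBit_orbitMask
      (P := fun x => ∃ hx : x < 2 ^ n, r ⟨0, Nat.two_pow_pos n⟩ ⟨x, hx⟩)
      (f := tableMate T c) (g := tableMate T' d)
      (fun x ⟨hx, hr⟩ => ⟨validTable.mate_lt hT x c hx c.2, r.trans hr (hf ⟨x, hx⟩)⟩)
      (fun x ⟨hx, hr⟩ => ⟨validTable.mate_lt hT' x d hx d.2, r.trans hr (hg ⟨x, hx⟩)⟩)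
      (2 ^ (n - 1)) 0 ⟨Nat.two_pow_pos n, r.refl _⟩ y
      (by rw [h, Nat.testBit_two_pow_sub_one]; simp)
    exact hy
  exact fun x y => r.trans (r.symm (h0 x)) (h0 y)

/-! ### Explicit twin colourings. -/

/-- First of two twin colourings of `Q_4`. -/
def tableA4 : List ℕ := [
  0x0000111111110000,
  0x2223222322232223,
  0x1111000000001111,
  0x3332333233323332]

/-- Second of two twin colourings of `Q_4`. -/
def tableB4 : List ℕ := [
  0x2223222322232223,
  0x0000111111110000,
  0x3332333233323332,
  0x1111000000001111]

/-- First of two twin colourings of `Q_5`. -/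
def tableA5 : List ℕ := [
  0x43003300131433004121312112143200,
  0x12121212000011111312003223002131,
  0x00444444224222420044444400420042,
  0x31310033313144333200121331214423,
  0x24232121442300242433230044331314]

/-- Second of two twin colourings of `Q_5`. -/
def tableB5 : List ℕ := [
  0x12124232240021313233423334330033,
  0x31210023312144232121212111114400,
  0x23332300433313141312131243001314,
  0x44441111004200424444000022422242,
  0x00003444121432000000344400243121]

/-- First of two twin colourings of `Q_6`. -/
def tableA6 : List ℕ := [
  0x0000111111110044333300003333554411110000414111110000111141415500,
  0x2223222344435553555233324442333233324442333255525553444322232223,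
  0x1111000055004400000011111111440000001111550000001111000000001111,
  0x3332333233343335222522232224222322232224222322253335333433323332,
  0x4444555500551111444455555555111144445555005544444444555555554444,
  0x5555444422222222111144440000005555553333141433332222222214140055]

/-- Second of two twin colourings of `Q_6`. -/
def tableB6 : List ℕ := [
  0x5554555422242225222422242224222555545554222422253334333433343335,
  0x0000111111110000111100000000111111110000000011110000111111110000,
  0x4445444544425552444244424442555244454445444255524443444344435553,
  0x1111000000001111000011111111000000001111111100001111000000001111,
  0x3333333333333333333333333333333333333333333333332222222222222222,
  0x2222222255554444555555555555444422222222555544445555555555554444]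

/-- First of two twin colourings of `Q_7`. -/
def tableA7 : List ℕ := [
  0x11110000000011110000111111110000000041411111660011114643212126230000111144220022111100554400111111110000000066000000365511113600,
  0x66633554662335245553555422232224333235523332356255535556121362006663333566433334555233325545333433344445333200625554444655256121,
  0x00001111111100561111000000001111111100000000415100000000660041611111000022002256220022001111000000001111111141511111131366004363,
  0x33364445333244423335444533324442222322252223222633353335333233323336555333344443332555233354444344435554222322264445553422522232,
  0x22222222226622006666666655666666444414146666141444441414556614142222222200665500666666660066666622222222666655442222222200660044,
  0x55555333555553332222222266555555555553335555533366666161005555555555444411111111003344446633555555553333444433336666616144445555,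
  0x44446666444466654444333344443333666666664444004522222222444400464444666655556665444411112222222266666666555514153333000033331416]

/-- Second of two twin colourings of `Q_7`. -/
def tableB7 : List ℕ := [
  0x33354443333444436662444255544445444566632224222344463336555433355554444355545553666444435554555355536663555355532226222655525552,
  0x11110000000011110000111111110000000011111111000011110000000011110000111111110000111100000000111111110000000011110000111111110000,
  0x55533334444333342226222444455554555433364442333266646663444555534445333444453335444633344445333533353336333533356662666222252225,
  0x00001111111100001111000000001111111100000000111100001111111100001111000000001111000011111111000000001111111100001111000000001111,
  0x44445555555555554444555522222222666655555555555533335555333366663333555533334444333355553333444466665555222222223333555533336666,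
  0x66666666666666663333333333333333222222226666444422222222666644446666666666666666222222222222222244444444666644444444444466664444,
  0x22222222222222225555666666666666333344443333666655554444222222222222222222222222555566666666666622222222444466665555333344443333]

/-- A colouring of `Q_4` whose last colour forms Hamilton cycles with the others. -/
def table31 : List ℕ := [
  0x2223222300230023,
  0x3300313133003131,
  0x1111000012121212,
  0x0032131221312300]

/-- The involution pairing the special colours. -/
def pairSwap : Fin 4 → Fin 4 := ![1, 0, 3, 2]

/-- `Q_n` has two perfect colourings whose corresponding colours form Hamilton cycles. -/
def HasTwins (n : ℕ) : Prop :=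
  ∃ A B : PerfectColoring (hypercube n) (Fin n), ∀ c, Interlaced (A.mate c) (B.mate c)

/-- `Q_n` has twin colourings in which moreover the first four colours are split into two pairs,
each pair forming a Hamilton cycle in both colourings. -/
def HasPairedTwins (n : ℕ) : Prop :=
  ∃ (D : Type) (_ : Fintype D) (A B : PerfectColoring (hypercube n) (Fin 4 ⊕ D)),
    Fintype.card D + 4 = n ∧ (∀ c, Interlaced (A.mate c) (B.mate c)) ∧
    (∀ s, Interlaced (A.mate (.inl s)) (A.mate (.inl (pairSwap s)))) ∧
    ∀ s, Interlaced (B.mate (.inl s)) (B.mate (.inl (pairSwap s)))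

theorem HasPairedTwins.hasTwins {n : ℕ} (h : HasPairedTwins n) : HasTwins n := by
  obtain ⟨D, _, A, B, hn, hAB, -, -⟩ := h
  let k : Fin n ≃ Fin 4 ⊕ D := Fintype.equivOfCardEq (by simp; omega)
  exact ⟨A.map .refl k, B.map .refl k, fun c => PerfectColoring.interlaced_map (hAB (k c)) .refl⟩

theorem hasTwins_of_table (T T' : List ℕ) (n : ℕ) (hT : validTable T n = true)
    (hT' : validTable T' n = true)
    (h : ∀ c < n, orbitMask (tableMate T c) (tableMate T' c) (2 ^ (n - 1)) 0 = 2 ^ 2 ^ n - 1) :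
    HasTwins n :=
  ⟨(tableColoring T n hT).map (cubeIso n) (.refl _),
    (tableColoring T' n hT').map (cubeIso n) (.refl _),
    fun c => PerfectColoring.interlaced_map (k := .refl _) (k' := .refl _)
      (tableColoring_interlaced hT hT' c c (h c c.2)) _⟩

theorem hasPairedTwins_of_table (T T' : List ℕ) (m : ℕ) (hT : validTable T (4 + m) = true)
    (hT' : validTable T' (4 + m) = true)
    (h : ∀ c < 4 + m,
      orbitMask (tableMate T c) (tableMate T' c) (2 ^ (3 + m)) 0 = 2 ^ 2 ^ (4 + m) - 1)
    (h₁ : ∀ s : Fin 4,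
      orbitMask (tableMate T s) (tableMate T (pairSwap s)) (2 ^ (3 + m)) 0 = 2 ^ 2 ^ (4 + m) - 1)
    (h₂ : ∀ s : Fin 4,
      orbitMask (tableMate T' s) (tableMate T' (pairSwap s)) (2 ^ (3 + m)) 0 =
        2 ^ 2 ^ (4 + m) - 1) :
    HasPairedTwins (4 + m) := by
  have e : 4 + m - 1 = 3 + m := by omega
  refine ⟨Fin m, inferInstance, (tableColoring T (4 + m) hT).map (cubeIso _) finSumFinEquiv,
    (tableColoring T' (4 + m) hT').map (cubeIso _) finSumFinEquiv, by simp; omega, fun c => ?_,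
    fun s => ?_, fun s => ?_⟩
  · exact PerfectColoring.interlaced_map (k := finSumFinEquiv) (k' := finSumFinEquiv)
      (tableColoring_interlaced hT hT' _ _ (by rw [e]; exact h _ (finSumFinEquiv c).2)) _
  · exact PerfectColoring.interlaced_map (k := finSumFinEquiv) (k' := finSumFinEquiv)
      (tableColoring_interlaced hT hT _ _ (by rw [e]; exact h₁ s)) _
  · exact PerfectColoring.interlaced_map (k := finSumFinEquiv) (k' := finSumFinEquiv)
      (tableColoring_interlaced hT' hT' _ _ (by rw [e]; exact h₂ s)) _

theorem validTable_A4 : validTable tableA4 4 = true := by decide +kernel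
theorem validTable_B4 : validTable tableB4 4 = true := by decide +kernel

theorem interlaced_A4_B4 (c : Fin 4) : Interlaced ((tableColoring tableA4 4 validTable_A4).mate c)
    ((tableColoring tableB4 4 validTable_B4).mate c) :=
  tableColoring_interlaced _ _ c c (by revert c; decide +kernel)

theorem hasTwins_one : HasTwins 1 :=
  hasTwins_of_table [0x00] [0x00] 1 (by decide +kernel) (by decide +kernel) (by decide +kernel)

theorem hasTwins_two : HasTwins 2 :=
  hasTwins_of_table [0x0000, 0x1111] [0x1111, 0x0000] 2 (by decide +kernel) (by decide +kernel)
    (by decide +kernel)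

theorem hasPairedTwins_four : HasPairedTwins 4 :=
  hasPairedTwins_of_table tableA4 tableB4 0 validTable_A4 validTable_B4 (by decide +kernel)
    (by decide +kernel) (by decide +kernel)

theorem hasPairedTwins_five : HasPairedTwins 5 :=
  hasPairedTwins_of_table tableA5 tableB5 1 (by decide +kernel) (by decide +kernel)
    (by decide +kernel) (by decide +kernel) (by decide +kernel)

theorem hasPairedTwins_six : HasPairedTwins 6 :=
  hasPairedTwins_of_table tableA6 tableB6 2 (by decide +kernel) (by decide +kernel)
    (by decide +kernel) (by decide +kernel) (by decide +kernel)

theorem hasPairedTwins_seven : HasPairedTwins 7 :=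
  hasPairedTwins_of_table tableA7 tableB7 3 (by decide +kernel) (by decide +kernel)
    (by decide +kernel) (by decide +kernel) (by decide +kernel)

/-! ### Semi-perfect colourings from twins. -/

/-- `Q_{k+l}` has a perfect colouring by `k` colours each forming a Hamilton cycle with each of
`l` further colours. -/
def HasSemiPerfect (k l : ℕ) : Prop :=
  ∃ A : PerfectColoring (hypercube (k + l)) (Fin k ⊕ Fin l),
    ∀ i j, Interlaced (A.mate (.inl i)) (A.mate (.inr j))

theorem HasSemiPerfect.symm {k l : ℕ} (h : HasSemiPerfect k l) : HasSemiPerfect l k := by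
  obtain ⟨A, hA⟩ := h
  let e : hypercube (k + l) ≃g hypercube (l + k) := Nat.add_comm k l ▸ SimpleGraph.Iso.refl
  exact ⟨A.map e (Equiv.sumComm _ _), fun i j => PerfectColoring.interlaced_map
    (k := Equiv.sumComm _ _) (k' := Equiv.sumComm _ _) (hA j i).symm e⟩

theorem hasSemiPerfect_of_table (T : List ℕ) (k l : ℕ) (hT : validTable T (k + l) = true)
    (h : ∀ (i : Fin k) (j : Fin l), orbitMask (tableMate T i) (tableMate T (k + j))
      (2 ^ (k + l - 1)) 0 = 2 ^ 2 ^ (k + l) - 1) : HasSemiPerfect k l :=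
  ⟨(tableColoring T (k + l) hT).map (cubeIso _) finSumFinEquiv, fun i j =>
    PerfectColoring.interlaced_map (k := finSumFinEquiv) (k' := finSumFinEquiv)
      (c := .inl i) (d := .inr j) (tableColoring_interlaced hT hT
        (finSumFinEquiv (.inl i)) (finSumFinEquiv (.inr j)) (h i j)) _⟩

theorem hasSemiPerfect_three_one : HasSemiPerfect 3 1 :=
  hasSemiPerfect_of_table table31 3 1 (by decide +kernel) (by decide +kernel)

/-- Parity makes any two adjacent rows carry different twins of `Q_k`; the column over `∅` is the
single one coloured by the second twin of `Q_l`. -/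
theorem HasTwins.hasSemiPerfect {k l : ℕ} (hk : HasTwins k) (hl : HasTwins l) :
    HasSemiPerfect k l := by
  obtain ⟨G₀, G₁, hG⟩ := hk
  obtain ⟨F₀, F₁, hF⟩ := hl
  let A := PerfectColoring.boxProd (fun y => if hypercubeParity y = false then G₀ else G₁)
    (fun x => if x = ∅ then F₁ else F₀)
  refine ⟨A.map (hypercubeBoxProdIso k l) (.refl _), fun i j =>
    PerfectColoring.interlaced_map (k := .refl _) (k' := .refl _) ?_ _⟩
  refine interlaced_rows_columns (hG i) (G₀.mate_mate i) (G₀.mate_ne i) (G₁.mate_mate i)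
    (G₁.mate_ne i) (hF j) hypercubeParity (fun y => hypercubeParity_of_adj (F₀.adj_mate j y)) ∅
    _ _ (fun x y hy => ?_) (fun x y hy => ?_) (fun x y hx => ?_) (fun y => ?_)
  · simp [A, PerfectColoring.boxProd, hy]
  · simp [A, PerfectColoring.boxProd, hy]
  · simp [A, PerfectColoring.boxProd, hx]
  · simp [A, PerfectColoring.boxProd]

/-! ### Gadgets: recolourings of `Q_4` times an edge. -/

/-- The local recolouring of `Q_5` used when colour 0 is closed. -/
def tableGadget0 : List ℕ := [
  0x22322232223222323300111133000000,
  0x43444141131444004244424300244423,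
  0x34001414314100442423242422432244,
  0x11110000440011110032333244323332,
  0x00233323002333231111000011111111]

/-- The local recolouring of `Q_5` used when colour 1 is closed. -/
def tableGadget1 : List ℕ := [
  0x34244423340044431414440014124442,
  0x00001111111100002333233323332333,
  0x43433344432333244141004441210024,
  0x11110000004411113222322232443200,
  0x22322232223222320000111100001111]

/-- The local recolouring of `Q_5` used when colour 2 is closed. -/
def tableGadget2 : List ℕ := [
  0x23222322234423001111000000441111,
  0x14144400141244423424442334004443,
  0x32333233323332330000111111110000,
  0x41410044412100244343334443233324,
  0x00001111000011112232223222322232]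

/-- The local recolouring of `Q_5` used when colour 3 is closed. -/
def tableGadget3 : List ℕ := [
  0x32424242322242220042434200004300,
  0x00001414111100002333243423332131,
  0x44243121444434444424312144443444,
  0x11110000000011113200121331210023,
  0x23332333233323331111000012121212]

/-- The local recolouring used at an edge of the given kind. -/
def gadgetTable : Fin 4 → List ℕ := ![tableGadget0, tableGadget1, tableGadget2, tableGadget3]

/-- The mates in a local recolouring of two adjacent rows, distinguished by a Boolean. The last
colour is that of the columns. -/
def gadgetMate (k : Fin 4) (j : Fin 5) (z : Fin (2 ^ 4) × Bool) : Fin (2 ^ 4) × Bool :=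
  let d := tableDir (gadgetTable k) j (z.1 + if z.2 then 16 else 0)
  if d < 4 then (Fin.ofNat (2 ^ 4) (z.1 ^^^ 2 ^ d), z.2) else (z.1, !z.2)

theorem gadgetMate_gadgetMate : ∀ k j z, gadgetMate k j (gadgetMate k j z) = z := by
  decide +kernel

theorem gadgetMate_inj : ∀ z k j j', gadgetMate k j z = gadgetMate k j' z → j = j' := by
  decide +kernel

theorem gadgetMate_adj (k : Fin 4) (j : Fin 5) (z : Fin (2 ^ 4) × Bool) :
    ((cubeGraph 4).Adj z.1 (gadgetMate k j z).1 ∧ (gadgetMate k j z).2 = z.2) ∨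
      ((gadgetMate k j z).1 = z.1 ∧ (gadgetMate k j z).2 = !z.2) := by
  have : ∀ k j z, (∃ d < 4, ((gadgetMate k j z).1 : ℕ) = z.1 ^^^ 2 ^ d) ∧
      (gadgetMate k j z).2 = z.2 ∨
      ((gadgetMate k j z).1 = z.1 ∧ (gadgetMate k j z).2 = !z.2) := by
    decide +kernel
  exact this k j z

/-- The two colourings of `Q_4` used in even and odd rows. -/
def rowColoring : Bool → PerfectColoring (cubeGraph 4) (Fin 4)
  | false => tableColoring tableA4 4 validTable_A4
  | true => tableColoring tableB4 4 validTable_B4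

theorem interlaced_rowColoring (ρ : Bool) (i : Fin 4) :
    Interlaced ((rowColoring ρ).mate i) ((rowColoring (!ρ)).mate i) := by
  cases ρ
  · exact interlaced_A4_B4 i
  · exact (interlaced_A4_B4 i).symm

/-- The column in which a special colour and its partner are exchanged. -/
def swapColumn : Fin 4 → Fin (2 ^ 4) := ![0, 0, 3, 3]

/-- The renaming of the special colours in a column. -/
def columnPerm (x : Fin (2 ^ 4)) : Equiv.Perm (Fin 4) :=
  Function.Involutive.toPerm (fun i => if swapColumn i = x then pairSwap i else i) (by
    intro i
    revert x i
    decide +kernel)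

theorem columnPerm_swapColumn (i : Fin 4) : columnPerm (swapColumn i) i = pairSwap i :=
  if_pos rfl

theorem columnPerm_of_ne {i : Fin 4} {x : Fin (2 ^ 4)} (h : x ≠ swapColumn i) :
    columnPerm x i = i :=
  if_neg h.symm

/-- The points visited from `x` by `k` rounds of `f` followed by `g`. -/
def orbitList {α : Type*} (f g : α → α) : ℕ → α → List α
  | 0, _ => []
  | k + 1, x => x :: f x :: orbitList f g k (g (f x))

theorem of_mem_orbitList {α : Type*} {f g : α → α} {P : α → Prop} (hf : ∀ x, P x → P (f x))
    (hg : ∀ x, P x → P (g x)) (k : ℕ) (x : α) (hx : P x) : ∀ y ∈ orbitList f g k x, P y := by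
  induction k generalizing x with
  | zero => simp [orbitList]
  | succ k ih =>
    simp only [orbitList, List.mem_cons, forall_eq_or_imp]
    exact ⟨hx, hf _ hx, ih _ (hg _ (hf _ hx))⟩

/-- The flip stands for the path that remains in a column when the gadget edge is removed from its
Hamilton cycle. Colour 4 of the gadget thus links all sixteen columns. -/
theorem mem_orbitList_column : ∀ k z,
    z ∈ orbitList (gadgetMate k 4) (fun z => (z.1, !z.2)) 16 (0, false) := by
  decide +kernel

/-- The steps between the two rows of a gadget, except in one column. -/
def closedStep (i : Fin 4) (z : Fin (2 ^ 4) × Bool) : Fin (2 ^ 4) × Bool :=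
  if z.1 = swapColumn i then z else (z.1, !z.2)

/-- The case where column colour `i` matches the two gadget rows with each other, except in
`swapColumn i`; only a gadget of kind `i` has to handle it. -/
theorem mem_orbitList_closed : ∀ i z,
    z ∈ orbitList (gadgetMate i i.castSucc) (closedStep i) 16 (swapColumn i, false) := by
  decide +kernel

/-- The steps leaving a gadget through a neighbouring row. -/
def openStep (i : Fin 4) (z : Fin (2 ^ 4) × Bool) : Fin (2 ^ 4) × Bool :=
  if z.1 = swapColumn i ∨ (rowColoring (!z.2)).mate i z.1 = swapColumn i then z
  else ((rowColoring (!z.2)).mate i z.1, z.2)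

/-- The case where column colour `i` leads from the gadget to ordinary rows. The point reached faces
the row mate of `swapColumn i` in the neighbouring row, so one rung and one row step arrive at the
neighbouring point of column `swapColumn i`. -/
theorem mem_orbitList_open : ∀ k i ρ, ((rowColoring (!ρ)).mate i (swapColumn i), ρ) ∈
    orbitList (gadgetMate k i.castSucc) (openStep i) 16 (swapColumn i, ρ) := by
  decide +kernel

/-- Every gadget point is attached to one of the two gadget points in column `swapColumn i`. -/
theorem mem_orbitList_open_union : ∀ k i z,
    z ∈ orbitList (gadgetMate k i.castSucc) (openStep i) 16 (swapColumn i, false) ∨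
    z ∈ orbitList (gadgetMate k i.castSucc) (openStep i) 16 (swapColumn i, true) := by
  decide +kernel

/-- A recolouring of the edges of a perfectly coloured graph by the same number of colours. -/
def PerfectColoring.recolor {V C : Type*} [Finite C] {G : SimpleGraph V} (A : PerfectColoring G C)
    (mate : C → V → V) (mate_mate : ∀ c x, mate c (mate c x) = x)
    (adj_mate : ∀ c x, G.Adj x (mate c x)) (mate_inj : ∀ x c d, mate c x = mate d x → c = d) :
    PerfectColoring G C where
  mate := mate
  mate_mate := mate_mate
  adj_mate := adj_mate
  mate_inj := mate_inj
  exists_mate_eq x y h := by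
    -- Each new edge at `x` has an old colour; this injective map on the finite set of colours is
    -- onto, so no edge is lost.
    choose e he using fun c => A.exists_mate_eq x (mate c x) (adj_mate c x)
    have hinj : Function.Injective e := fun c d hcd =>
      mate_inj x c d (by rw [← he c, ← he d, hcd])
    obtain ⟨c, hc⟩ := A.exists_mate_eq x y h
    obtain ⟨c', rfl⟩ := Finite.injective_iff_surjective.1 hinj c
    exact ⟨c', by rw [← he, hc]⟩

/-! ### Layered colourings and the insertion of gadgets. -/

section Layered

variable {V D : Type*} {H : SimpleGraph V}

/-- A colouring of `Q_4 □ H` whose rows alternate between two colourings of `Q_4`, and whose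
columns are coloured as `H` up to exchanging special colours. -/
def layered (par : V → Bool) (A : PerfectColoring H (Fin 4 ⊕ D)) :
    PerfectColoring ((cubeGraph 4).boxProd H) (Fin 4 ⊕ (Fin 4 ⊕ D)) :=
  .boxProd (fun y => rowColoring (par y))
    (fun x => A.map .refl ((columnPerm x).sumCongr (.refl D)))

variable {par : V → Bool} (A : PerfectColoring H (Fin 4 ⊕ D))

@[simp] theorem layered_row (i : Fin 4) (z : Fin (2 ^ 4) × V) :
    (layered par A).mate (.inl i) z = ((rowColoring (par z.2)).mate i z.1, z.2) := rfl

@[simp] theorem layered_column (i : Fin 4) (z : Fin (2 ^ 4) × V) :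
    (layered par A).mate (.inr (.inl i)) z = (z.1, A.mate (.inl (columnPerm z.1 i)) z.2) := rfl

@[simp] theorem layered_rest (d : D) (z : Fin (2 ^ 4) × V) :
    (layered par A).mate (.inr (.inr d)) z = (z.1, A.mate (.inr d) z.2) := rfl

variable {A}

/-- The deviating column is `swapColumn i`, where the partner `pairSwap i` replaces colour `i`; this
is what the Hamilton pairs in the induction are for. -/
theorem interlaced_layered (hpar : ∀ x y, H.Adj x y → par y = !par x)
    (B : PerfectColoring H (Fin 4 ⊕ D)) {i : Fin 4}
    (h : Interlaced (B.mate (.inl i)) (B.mate (.inl (pairSwap i)))) :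
    Interlaced ((layered par A).mate (.inl i)) ((layered par B).mate (.inr (.inl i))) := by
  refine interlaced_rows_columns (interlaced_rowColoring false i) (PerfectColoring.mate_mate _ i)
    (PerfectColoring.mate_ne _ i) (PerfectColoring.mate_mate _ i) (PerfectColoring.mate_ne _ i) h par
    (fun y => hpar _ _ (B.adj_mate _ y)) (swapColumn i) _ _ (fun x y hy => ?_) (fun x y hy => ?_)
    (fun x y hx => ?_) (fun y => ?_)
  · simp [hy]
  · simp [hy]
  · simp [columnPerm_of_ne hx]
  · simp [columnPerm_swapColumn]

end Layered

/-- A choice of an edge of each non-special colour of `A`, at pairwise distance at least two.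
Edges coincide with edges of `B` of at most the special colour given by `kind`. -/
structure GadgetPlacement {V D : Type*} {H : SimpleGraph V} (par : V → Bool)
    (A B : PerfectColoring H (Fin 4 ⊕ D)) where
  loc : V → Option D
  kind : V → Fin 4
  par_adj : ∀ x y, H.Adj x y → par y = !par x
  loc_mate : ∀ y t, loc y = some t → loc (A.mate (.inr t) y) = some t
  kind_mate : ∀ y t, loc y = some t → kind (A.mate (.inr t) y) = kind y
  kind_eq : ∀ y t s, loc y = some t → B.mate (.inl s) y = A.mate (.inr t) y → kind y = s
  exists_loc : ∀ t, ∃ y, loc y = some t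
  eq_of_adj : ∀ y z t t', loc y = some t → loc z = some t' → H.Adj y z → z = A.mate (.inr t) y
  eq_or_eq : ∀ y z t, loc y = some t → loc z = some t → z = y ∨ z = A.mate (.inr t) y

namespace GadgetPlacement

variable {V D : Type*} {H : SimpleGraph V} {par : V → Bool} {A B : PerfectColoring H (Fin 4 ⊕ D)}
  (P : GadgetPlacement par A B)

/-- The row of given parity of the gadget at `y`. -/
def row (A : PerfectColoring H (Fin 4 ⊕ D)) (par : V → Bool) (t : D) (y : V) (ρ : Bool) : V :=
  if par y = ρ then y else A.mate (.inr t) y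

/-- The mates in the gadget at `z`. -/
def localMate (t : D) (j : Fin 5) (z : Fin (2 ^ 4) × V) : Fin (2 ^ 4) × V :=
  let w := gadgetMate (P.kind z.2) j (z.1, par z.2)
  (w.1, row A par t z.2 w.2)

include P in
theorem par_mate (c : Fin 4 ⊕ D) (y : V) : par (A.mate c y) = !par y :=
  P.par_adj _ _ (A.adj_mate c y)

theorem row_self (t : D) (y : V) : row A par t y (par y) = y := if_pos rfl

theorem row_not (t : D) (y : V) : row A par t y (!par y) = A.mate (.inr t) y :=
  if_neg (by simp)

theorem row_eq_or (t : D) (y : V) (ρ : Bool) :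
    row A par t y ρ = y ∨ row A par t y ρ = A.mate (.inr t) y := by
  unfold row; split_ifs <;> simp

include P

theorem par_row (t : D) (y : V) (ρ : Bool) : par (row A par t y ρ) = ρ := by
  unfold row
  split_ifs with h
  · exact h
  · rw [P.par_mate]
    cases ρ <;> simpa using h

theorem row_row (t : D) (y : V) (ρ ρ' : Bool) :
    row A par t (row A par t y ρ) ρ' = row A par t y ρ' := by
  by_cases h : par y = ρ
  · rw [row, row, if_pos h]; rfl
  · rw [show row A par t y ρ = A.mate (.inr t) y from if_neg h]
    unfold row
    rw [P.par_mate, A.mate_mate]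
    by_cases h' : par y = ρ'
    · rw [if_neg, if_pos h']; simp [h']
    · rw [if_pos, if_neg h']; cases hy : par y <;> cases ρ' <;> simp_all

theorem loc_row {t : D} {y : V} (h : P.loc y = some t) (ρ : Bool) :
    P.loc (row A par t y ρ) = some t := by
  obtain h' | h' := row_eq_or (A := A) (par := par) t y ρ <;> rw [h']
  · exact h
  · exact P.loc_mate y t h

theorem kind_row {t : D} {y : V} (h : P.loc y = some t) (ρ : Bool) :
    P.kind (row A par t y ρ) = P.kind y := by
  obtain h' | h' := row_eq_or (A := A) (par := par) t y ρ <;> rw [h']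
  exact P.kind_mate y t h

theorem localMate_row {t : D} {y : V} (h : P.loc y = some t) (j : Fin 5) (x : Fin (2 ^ 4))
    (ρ : Bool) : P.localMate t j (x, row A par t y ρ) =
      ((gadgetMate (P.kind y) j (x, ρ)).1, row A par t y (gadgetMate (P.kind y) j (x, ρ)).2) := by
  simp only [localMate, P.kind_row h, P.par_row, P.row_row]

theorem localMate_localMate {t : D} {z : Fin (2 ^ 4) × V} (h : P.loc z.2 = some t) (j : Fin 5) :
    P.localMate t j (P.localMate t j z) = z := by
  change P.localMate t j (_, row A par t z.2 _) = z
  rw [P.localMate_row h]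
  change ((gadgetMate _ j (gadgetMate _ j (z.1, par z.2))).1,
    row A par t z.2 (gadgetMate _ j (gadgetMate _ j (z.1, par z.2))).2) = z
  rw [gadgetMate_gadgetMate, row_self]

theorem localMate_cases (t : D) (j : Fin 5) (z : Fin (2 ^ 4) × V) :
    ((cubeGraph 4).Adj z.1 (P.localMate t j z).1 ∧ (P.localMate t j z).2 = z.2) ∨
      P.localMate t j z = (z.1, A.mate (.inr t) z.2) := by
  obtain ⟨h, h'⟩ | ⟨h, h'⟩ := gadgetMate_adj (P.kind z.2) j (z.1, par z.2)
  · refine Or.inl ⟨h, ?_⟩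
    simp only [localMate, h', row_self]
  · refine Or.inr ?_
    simp only [localMate, h, h', row_not]

theorem localMate_inj {t : D} {j j' : Fin 5} {z : Fin (2 ^ 4) × V}
    (h : P.localMate t j z = P.localMate t j' z) : j = j' := by
  apply gadgetMate_inj (z.1, par z.2) (P.kind z.2)
  have h₂ := congrArg (fun w => par w.2) h
  simp only [localMate, P.par_row] at h₂
  exact Prod.ext (congrArg (fun w => w.1) h) h₂

/-- A gadget uses only row edges and column edges of colour `t` of `A`, so it cannot collide with
the other column colours. -/
theorem localMate_ne {t : D} {j : Fin 5} {z : Fin (2 ^ 4) × V} {c : Fin 4 ⊕ D}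
    (hc : c ≠ .inr t) : P.localMate t j z ≠ (z.1, A.mate c z.2) := by
  intro h
  obtain ⟨h', -⟩ | h' := P.localMate_cases t j z
  · rw [h] at h'; exact h'.ne rfl
  · rw [h, Prod.mk.injEq] at h'
    exact hc (A.mate_inj _ _ _ h'.2)

open scoped Classical in
/-- The layered colouring modified by gadgets. -/
noncomputable def mate : Fin 4 ⊕ (Fin 4 ⊕ D) → Fin (2 ^ 4) × V → Fin (2 ^ 4) × V
  | .inl i, z => match P.loc z.2 with
    | none => (layered par A).mate (.inl i) z
    | some t => P.localMate t i.castSucc z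
  | .inr (.inl i), z => (layered par A).mate (.inr (.inl i)) z
  | .inr (.inr d), z => if P.loc z.2 = some d then P.localMate d 4 z
    else (layered par A).mate (.inr (.inr d)) z

theorem mate_row_none {z : Fin (2 ^ 4) × V} (h : P.loc z.2 = none) (i : Fin 4) :
    P.mate (.inl i) z = ((rowColoring (par z.2)).mate i z.1, z.2) := by
  simp [mate, h]

theorem mate_row_some {z : Fin (2 ^ 4) × V} {t : D} (h : P.loc z.2 = some t) (i : Fin 4) :
    P.mate (.inl i) z = P.localMate t i.castSucc z := by
  simp [mate, h]

theorem mate_column (i : Fin 4) (z : Fin (2 ^ 4) × V) :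
    P.mate (.inr (.inl i)) z = (layered par A).mate (.inr (.inl i)) z := by
  simp [mate]

theorem mate_rest_some {z : Fin (2 ^ 4) × V} {t : D} (h : P.loc z.2 = some t) :
    P.mate (.inr (.inr t)) z = P.localMate t 4 z := by
  simp [mate, h]

theorem mate_rest_of_ne {z : Fin (2 ^ 4) × V} {t : D} (h : P.loc z.2 ≠ some t) :
    P.mate (.inr (.inr t)) z = (z.1, A.mate (.inr t) z.2) := by
  simp [mate, h]

theorem loc_localMate {t : D} {z : Fin (2 ^ 4) × V} (h : P.loc z.2 = some t) (j : Fin 5) :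
    P.loc (P.localMate t j z).2 = some t := P.loc_row h _

theorem mate_mate (c : Fin 4 ⊕ (Fin 4 ⊕ D)) (z : Fin (2 ^ 4) × V) :
    P.mate c (P.mate c z) = z := by
  rcases c with i | i | d
  · cases h : P.loc z.2 with
    | none =>
      rw [P.mate_row_none h, P.mate_row_none (by exact h)]
      simp [PerfectColoring.mate_mate]
    | some t =>
      rw [P.mate_row_some h, P.mate_row_some (P.loc_localMate h _), P.localMate_localMate h]
  · rw [P.mate_column, P.mate_column, PerfectColoring.mate_mate]
  · by_cases h : P.loc z.2 = some d
    · rw [P.mate_rest_some h, P.mate_rest_some (P.loc_localMate h _), P.localMate_localMate h]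
    · have h' : P.loc (A.mate (.inr d) z.2) ≠ some d := fun h' => h (by
        have := P.loc_mate _ _ h'
        rwa [A.mate_mate] at this)
      rw [P.mate_rest_of_ne h, P.mate_rest_of_ne h', A.mate_mate]

theorem adj_localMate {t : D} (j : Fin 5) (z : Fin (2 ^ 4) × V) :
    ((cubeGraph 4).boxProd H).Adj z (P.localMate t j z) := by
  rw [SimpleGraph.boxProd_adj]
  obtain ⟨h, h'⟩ | h := P.localMate_cases t j z
  · exact Or.inl ⟨h, h'.symm⟩
  · rw [h]; exact Or.inr ⟨A.adj_mate _ _, rfl⟩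

theorem adj_mate (c : Fin 4 ⊕ (Fin 4 ⊕ D)) (z : Fin (2 ^ 4) × V) :
    ((cubeGraph 4).boxProd H).Adj z (P.mate c z) := by
  rcases c with i | i | d
  · cases h : P.loc z.2 with
    | none =>
      rw [P.mate_row_none h]
      exact (layered par A).adj_mate (.inl i) z
    | some t => rw [P.mate_row_some h]; exact P.adj_localMate _ _
  · rw [P.mate_column]; exact (layered par A).adj_mate _ z
  · by_cases h : P.loc z.2 = some d
    · rw [P.mate_rest_some h]; exact P.adj_localMate _ _
    · rw [P.mate_rest_of_ne h]
      exact (layered par A).adj_mate (.inr (.inr d)) z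

theorem mate_inj (z : Fin (2 ^ 4) × V) (c c' : Fin 4 ⊕ (Fin 4 ⊕ D))
    (h : P.mate c z = P.mate c' z) : c = c' := by
  cases hz : P.loc z.2 with
  | none =>
    have : ∀ c, P.mate c z = (layered par A).mate c z := by
      rintro (i | i | d)
      · rw [P.mate_row_none hz]; rfl
      · rw [P.mate_column]
      · rw [P.mate_rest_of_ne (by simp [hz])]; rfl
    rw [this, this] at h
    exact (layered par A).mate_inj _ _ _ h
  | some t =>
    -- At a gadget point five colours are local; all others keep their column edges.
    have key : ∀ c, (∃ i : Fin 4, c = .inl i ∧ P.mate c z = P.localMate t i.castSucc z) ∨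
        (c = .inr (.inr t) ∧ P.mate c z = P.localMate t 4 z) ∨
        ∃ e : Fin 4 ⊕ D, ∃ e' : Fin 4 ⊕ D, e' ≠ .inr t ∧ c = .inr e ∧
          P.mate c z = (layered par A).mate (.inr e) z ∧ P.mate c z = (z.1, A.mate e' z.2) := by
      rintro (i | i | d)
      · exact Or.inl ⟨i, rfl, P.mate_row_some hz i⟩
      · exact Or.inr (Or.inr ⟨.inl i, .inl (columnPerm z.1 i), by simp, rfl, P.mate_column i z,
          P.mate_column i z⟩)
      · by_cases hd : d = t
        · subst hd
          exact Or.inr (Or.inl ⟨rfl, P.mate_rest_some hz⟩)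
        · have := P.mate_rest_of_ne (z := z) (t := d) (by rw [hz]; simpa using Ne.symm hd)
          exact Or.inr (Or.inr ⟨.inr d, .inr d, by simpa using hd, rfl, this, this⟩)
    obtain ⟨i, rfl, hi⟩ | ⟨rfl, hi⟩ | ⟨e, e', he', rfl, hi, hi'⟩ := key c <;>
      obtain ⟨j, rfl, hj⟩ | ⟨rfl, hj⟩ | ⟨u, u', hu', rfl, hj, hj'⟩ := key c'
    · rw [hi, hj] at h
      rw [Fin.castSucc_injective _ (P.localMate_inj h)]
    · rw [hi, hj] at h
      exact absurd (P.localMate_inj h) (Fin.castSucc_ne_last i)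
    · rw [hi, hj'] at h
      exact absurd h (P.localMate_ne hu')
    · rw [hi, hj] at h
      exact absurd (P.localMate_inj h).symm (Fin.castSucc_ne_last j)
    · rfl
    · rw [hi, hj'] at h
      exact absurd h (P.localMate_ne hu')
    · rw [hi', hj] at h
      exact absurd h.symm (P.localMate_ne he')
    · rw [hi', hj] at h
      exact absurd h.symm (P.localMate_ne he')
    · rw [hi, hj] at h
      exact (layered par A).mate_inj _ _ _ h

/-- The layered colouring modified by gadgets. -/
noncomputable def coloring [Finite D] :
    PerfectColoring ((cubeGraph 4).boxProd H) (Fin 4 ⊕ (Fin 4 ⊕ D)) :=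
  (layered par A).recolor P.mate P.mate_mate P.adj_mate P.mate_inj

end GadgetPlacement

/-! ### Hamilton cycles through the gadgets. -/

namespace GadgetPlacement

variable {V D : Type*} {H : SimpleGraph V} {par : V → Bool} {A B : PerfectColoring H (Fin 4 ⊕ D)}
  (P : GadgetPlacement par A B)

include P

/-- In each column the cycle formed by colour `d` of `A` and of `B` loses at most the gadget edge
and stays connected; the gadget of `d` links the columns. -/
theorem interlaced_rest [Finite V] {d : D}
    (h : Interlaced (A.mate (.inr d)) (B.mate (.inr d))) :
    Interlaced (P.mate (.inr (.inr d))) ((layered par B).mate (.inr (.inr d))) := by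
  intro r hA hB
  obtain ⟨y₀, hy₀⟩ := P.exists_loc d
  have col : ∀ x y y', r (x, y) (x, y') := fun x => by
    refine h.rel_of_cut_edge (A.mate_mate _) (A.mate_ne _) (B.mate_mate _) (B.mate_ne _) r
      (fun y => (x, y)) y₀ (fun y h₁ h₂ => ?_) (fun y => hB (x, y))
    have : P.loc y ≠ some d := fun h' => by
      obtain h | h := P.eq_or_eq _ _ _ hy₀ h'
      exacts [h₁ h, h₂ h]
    have := P.mate_rest_of_ne (z := (x, y)) this
    exact this ▸ hA (x, y)
  have all : ∀ z : Fin (2 ^ 4) × Bool, r (0, row A par d y₀ false) (z.1, row A par d y₀ z.2) :=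
    fun z => of_mem_orbitList
      (P := fun z => r (0, row A par d y₀ false) (z.1, row A par d y₀ z.2))
      (f := gadgetMate (P.kind y₀) 4) (g := fun z => (z.1, !z.2))
      (fun z hz => r.trans hz (by
        have := hA (z.1, row A par d y₀ z.2)
        rwa [P.mate_rest_some (P.loc_row hy₀ _), P.localMate_row hy₀] at this))
      (fun z hz => r.trans hz (col _ _ _)) 16 (0, false) (r.refl _) z (mem_orbitList_column _ z)
  have h0 : ∀ z, r (0, y₀) z := fun z =>
    r.trans (r.trans (col _ _ _) (all (z.1, false))) (col _ _ _)
  exact fun z z' => r.trans (r.symm (h0 z)) (h0 z')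

/-- The rows containing gadgets form a Hamilton cycle with any columns compatible with them. -/
theorem interlaced_row {F F' : V → V} {i : Fin 4} (hF : Interlaced F F')
    (hFF : ∀ y, F (F y) = y) (hadj : ∀ y, H.Adj y (F y))
    (hkind : ∀ y t, P.loc y = some t → F y = A.mate (.inr t) y → P.kind y = i)
    {b : Fin (2 ^ 4) × V → Fin (2 ^ 4) × V}
    (hb : ∀ x y, x ≠ swapColumn i → b (x, y) = (x, F y))
    (hb' : ∀ y, b (swapColumn i, y) = (swapColumn i, F' y)) :
    Interlaced (P.mate (.inl i)) b := by
  intro r hrow hcol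
  have hF_rel : ∀ x y, x ≠ swapColumn i → r (x, y) (x, F y) := fun x y hx => by
    rw [← hb x y hx]; exact hcol _
  have hrow_none : ∀ x y, P.loc y = none → r (x, y) ((rowColoring (par y)).mate i x, y) :=
    fun x y h => by
      have := P.mate_row_none (z := (x, y)) h i
      exact this ▸ hrow _
  have hrow_some : ∀ y t, P.loc y = some t → ∀ z : Fin (2 ^ 4) × Bool, r (z.1, row A par t y z.2)
      ((gadgetMate (P.kind y) i.castSucc z).1,
        row A par t y (gadgetMate (P.kind y) i.castSucc z).2) := fun y t h z => by
    have := hrow (z.1, row A par t y z.2)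
    rwa [P.mate_row_some (P.loc_row h _), P.localMate_row h] at this
  -- Either `F` matches the two gadget rows with each other, and `hkind` provides the gadget of kind
  -- `i`, or `F` leads from both to rows without gadgets, since gadgets are far apart.
  have hsome : ∀ y t, P.loc y = some t → r (swapColumn i, y) (swapColumn i, F y) ∧
      ∀ x, ∃ y', r (swapColumn i, y') (x, y) := by
    intro y t hy
    by_cases hc : F y = A.mate (.inr t) y
    · have all : ∀ z : Fin (2 ^ 4) × Bool,
          r (swapColumn i, row A par t y false) (z.1, row A par t y z.2) := fun z => by
        refine of_mem_orbitList
          (P := fun z => r (swapColumn i, row A par t y false) (z.1, row A par t y z.2))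
          (f := gadgetMate i i.castSucc) (g := closedStep i)
          (fun z hz => r.trans hz ?_) (fun z hz => r.trans hz ?_)
          16 (swapColumn i, false) (r.refl _) z (mem_orbitList_closed i z)
        · have := hrow_some y t hy z
          rwa [hkind y t hy hc] at this
        · unfold closedStep
          split_ifs with hx
          · exact r.refl _
          · have hF' : row A par t y (!z.2) = F (row A par t y z.2) := by
              cases hz2 : z.2 <;> cases hp : par y <;> simp [row, hp, ← hc, hFF]
            change r _ (z.1, row A par t y (!z.2))
            rw [hF']
            exact hF_rel _ _ hx
      have h₁ := all (swapColumn i, par y)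
      have h₂ := all (swapColumn i, !par y)
      rw [row_self] at h₁
      rw [row_not, ← hc] at h₂
      refine ⟨r.trans (r.symm h₁) h₂, fun x => ⟨row A par t y false, ?_⟩⟩
      have h₃ := all (x, par y)
      rw [row_self] at h₃
      exact h₃
    · have hne : ∀ ρ, F (row A par t y ρ) ≠ A.mate (.inr t) (row A par t y ρ) := fun ρ h => by
        obtain h' | h' := row_eq_or (A := A) (par := par) t y ρ <;> rw [h'] at h
        · exact hc h
        · rw [A.mate_mate] at h
          exact hc (by rw [← h, hFF, h])
      have hout : ∀ ρ, P.loc (F (row A par t y ρ)) = none := fun ρ => by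
        by_contra h
        obtain ⟨t', ht'⟩ := Option.ne_none_iff_exists'.1 h
        exact hne ρ (P.eq_of_adj _ _ _ _ (P.loc_row hy ρ) ht' (hadj _))
      have hparF : ∀ ρ, par (F (row A par t y ρ)) = !ρ := fun ρ => by
        rw [P.par_adj _ _ (hadj _), P.par_row]
      have hstep : ∀ x ρ, r (x, F (row A par t y ρ))
          ((rowColoring (!ρ)).mate i x, F (row A par t y ρ)) := fun x ρ => by
        have := hrow_none x _ (hout ρ)
        rwa [hparF] at this
      have hopen : ∀ z : Fin (2 ^ 4) × Bool, r (z.1, row A par t y z.2)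
          ((openStep i z).1, row A par t y (openStep i z).2) := fun z => by
        unfold openStep
        split_ifs with hx
        · exact r.refl _
        · rw [not_or] at hx
          exact r.trans (hF_rel _ _ hx.1) (r.trans (hstep _ _) (r.symm (hF_rel _ _ hx.2)))
      have walk : ∀ (ρ : Bool) (z : Fin (2 ^ 4) × Bool),
          z ∈ orbitList (gadgetMate (P.kind y) i.castSucc) (openStep i) 16 (swapColumn i, ρ) →
          r (swapColumn i, row A par t y ρ) (z.1, row A par t y z.2) := fun ρ z =>
        of_mem_orbitList
          (P := fun z => r (swapColumn i, row A par t y ρ) (z.1, row A par t y z.2))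
          (fun z hz => r.trans hz (hrow_some y t hy z)) (fun z hz => r.trans hz (hopen z))
          16 (swapColumn i, ρ) (r.refl _) z
      constructor
      · have h₁ := walk (par y) _ (mem_orbitList_open (P.kind y) i (par y))
        have h₂ := hstep (swapColumn i) (par y)
        have hx : (rowColoring (!par y)).mate i (swapColumn i) ≠ swapColumn i :=
          PerfectColoring.mate_ne _ _ _
        have h₃ := hF_rel _ (row A par t y (par y)) hx
        have := r.trans h₁ (r.trans h₃ (r.symm h₂))
        rwa [row_self] at this
      · intro x
        have h := mem_orbitList_open_union (P.kind y) i (x, par y)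
        rcases h with h | h
        · have := walk _ _ h
          rw [row_self] at this
          exact ⟨_, this⟩
        · have := walk _ _ h
          rw [row_self] at this
          exact ⟨_, this⟩
  have hall : ∀ y, r (swapColumn i, y) (swapColumn i, F y) ∧
      ∀ x, ∃ y', r (swapColumn i, y') (x, y) := by
    intro y
    cases hy : P.loc y with
    | some t => exact hsome y t hy
    | none =>
      cases hy' : P.loc (F y) with
      | some t =>
        obtain ⟨h₁, h₂⟩ := hsome _ _ hy'
        rw [hFF] at h₁
        refine ⟨r.symm h₁, fun x => ?_⟩
        by_cases hx : x = swapColumn i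
        · subst hx; exact ⟨y, r.refl _⟩
        · obtain ⟨y', h⟩ := h₂ x
          exact ⟨y', r.trans h (r.symm (hF_rel _ _ hx))⟩
      | none =>
        have hp : par (F y) = !par y := P.par_adj _ _ (hadj y)
        have := (interlaced_rowColoring (par y) i).rel_of_cut_vertex
          (PerfectColoring.mate_mate _ i) (PerfectColoring.mate_ne _ i)
          (PerfectColoring.mate_mate _ i) (PerfectColoring.mate_ne _ i)
          r (fun x => (x, y)) (fun x => (x, F y)) (swapColumn i)
          (fun x => hrow_none x y hy)
          (fun x => by have := hrow_none x _ hy'; rwa [hp] at this) (fun x hx => hF_rel x y hx)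
        exact ⟨r.symm (this _).2, fun x => ⟨y, r.symm (this x).1⟩⟩
  -- In column `swapColumn i` the steps of `F` are replaced by detours through the rows, while those
  -- of `F'` are actual edges.
  have col := hF.comap_rel r (fun y => (swapColumn i, y)) (fun y => (hall y).1)
    (fun y => by rw [← hb' y]; exact hcol _)
  rintro ⟨x, y⟩ ⟨x', y'⟩
  obtain ⟨u, hu⟩ := (hall y).2 x
  obtain ⟨u', hu'⟩ := (hall y').2 x'
  exact r.trans (r.symm hu) (r.trans (col u u') hu')

end GadgetPlacement

/-! ### Placing the gadgets far apart. -/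

/-- Box products of isomorphic graphs are isomorphic. -/
def SimpleGraph.Iso.boxProd {V V' W W' : Type*} {G : SimpleGraph V} {G' : SimpleGraph V'}
    {H : SimpleGraph W} {H' : SimpleGraph W'} (e : G ≃g G') (f : H ≃g H') :
    G.boxProd H ≃g G'.boxProd H' where
  toEquiv := e.toEquiv.prodCongr f.toEquiv
  map_rel_iff' := by
    intro x y
    rw [SimpleGraph.boxProd_adj, SimpleGraph.boxProd_adj]
    exact or_congr (and_congr e.map_rel_iff f.injective.eq_iff)
      (and_congr f.map_rel_iff e.injective.eq_iff)

section Placement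

variable {V D : Type*} {H : SimpleGraph V}

/-- The end points of an edge of colour `t`. -/
def edgeEnd (A : PerfectColoring H (Fin 4 ⊕ D)) (t : D) (y : V) (e : Bool) : V :=
  if e then A.mate (.inr t) y else y

/-- The points at distance at most one. -/
def nearby (A : PerfectColoring H (Fin 4 ⊕ D)) (c : Option (Fin 4 ⊕ D)) (y : V) : V :=
  c.elim y fun c => A.mate c y

theorem edgeEnd_edgeEnd (A : PerfectColoring H (Fin 4 ⊕ D)) (t : D) (y : V) (e : Bool) :
    edgeEnd A t (edgeEnd A t y e) e = y := by
  cases e <;> simp [edgeEnd, A.mate_mate]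

theorem mate_edgeEnd (A : PerfectColoring H (Fin 4 ⊕ D)) (t : D) (y : V) (e : Bool) :
    A.mate (.inr t) (edgeEnd A t y e) = edgeEnd A t y (!e) := by
  cases e <;> simp [edgeEnd, A.mate_mate]

theorem nearby_nearby (A : PerfectColoring H (Fin 4 ⊕ D)) (c : Option (Fin 4 ⊕ D)) (y : V) :
    nearby A c (nearby A c y) = y := by
  cases c <;> simp [nearby, A.mate_mate]

/-- In a sufficiently large graph, edges of all non-special colours can be chosen far apart. -/
theorem exists_distant_edges [Fintype V] [Fintype D] (A : PerfectColoring H (Fin 4 ⊕ D))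
    (hcard : (Fintype.card D - 1) * (4 * (Fintype.card D + 5)) < Fintype.card V) :
    ∃ y : D → V, ∀ s t, s ≠ t → ∀ e e' c,
      edgeEnd A t (y t) e ≠ nearby A c (edgeEnd A s (y s) e') := by
  classical
  have : Nonempty V := Fintype.card_pos_iff.1 (by omega)
  suffices ∀ S : Finset D, ∃ y : D → V, ∀ s ∈ S, ∀ t ∈ S, s ≠ t → ∀ e e' c,
      edgeEnd A t (y t) e ≠ nearby A c (edgeEnd A s (y s) e') by
    obtain ⟨y, hy⟩ := this Finset.univ
    exact ⟨y, fun s t => hy s (Finset.mem_univ s) t (Finset.mem_univ t)⟩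
  intro S
  induction S using Finset.induction_on with
  | empty => exact ⟨fun _ => Classical.arbitrary V, by simp⟩
  | insert t S ht ih =>
    obtain ⟨y, hy⟩ := ih
    -- The excluded base points: an earlier edge, one of its ends, a point within distance one of
    -- it, and the end of the new edge that would land there. Each earlier edge excludes at most `4
    -- * (card D + 5)` points.
    let φ : D × Bool × Option (Fin 4 ⊕ D) × Bool → V := fun q =>
      edgeEnd A t (nearby A q.2.2.1 (edgeEnd A q.1 (y q.1) q.2.1)) q.2.2.2
    have hS : S.card ≤ Fintype.card D - 1 := by
      have : (insert t S).card ≤ Fintype.card D := Finset.card_le_univ _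
      rw [Finset.card_insert_of_notMem ht] at this
      omega
    have hlt : ((S ×ˢ Finset.univ).image φ).card < (Finset.univ : Finset V).card := by
      refine (Finset.card_image_le.trans ?_).trans_lt (hcard.trans_eq Finset.card_univ.symm)
      rw [Finset.card_product, Finset.card_univ]
      refine Nat.mul_le_mul hS ?_
      simp only [Fintype.card_prod, Fintype.card_bool, Fintype.card_option, Fintype.card_sum,
        Fintype.card_fin]
      omega
    obtain ⟨v, -, hv⟩ := Finset.exists_mem_notMem_of_card_lt_card hlt
    have hfar : ∀ s ∈ S, ∀ e e' c, edgeEnd A t v e ≠ nearby A c (edgeEnd A s (y s) e') := by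
      intro s hs e e' c h
      refine hv (Finset.mem_image.2 ⟨(s, e', c, e), by simp [hs], ?_⟩)
      simp only [φ]
      rw [← h, edgeEnd_edgeEnd]
    refine ⟨Function.update y t v, ?_⟩
    have hne : ∀ s ∈ S, s ≠ t := fun s hs h => ht (h ▸ hs)
    intro s hs u hu hsu e e' c
    rcases Finset.mem_insert.1 hs with rfl | hs'
    · rcases Finset.mem_insert.1 hu with rfl | hu'
      · exact absurd rfl hsu
      · rw [Function.update_self, Function.update_of_ne (hne u hu')]
        intro h
        exact hfar u hu' e' e c (by rw [h, nearby_nearby])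
    · rcases Finset.mem_insert.1 hu with rfl | hu'
      · rw [Function.update_self, Function.update_of_ne (hne s hs')]
        exact hfar s hs' e e' c
      · rw [Function.update_of_ne (hne s hs'), Function.update_of_ne (hne u hu')]
        exact hy s hs' u hu' hsu e e' c

theorem nonempty_gadgetPlacement [Fintype V] [Fintype D] {par : V → Bool}
    (hpar : ∀ x y, H.Adj x y → par y = !par x) (A B : PerfectColoring H (Fin 4 ⊕ D))
    (hcard : (Fintype.card D - 1) * (4 * (Fintype.card D + 5)) < Fintype.card V) :
    Nonempty (GadgetPlacement par A B) := by
  classical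
  obtain ⟨y, hy⟩ := exists_distant_edges A hcard
  let loc : V → Option D := fun v =>
    if h : ∃ t, ∃ e, v = edgeEnd A t (y t) e then some h.choose else none
  have loc_iff : ∀ v t, loc v = some t ↔ ∃ e, v = edgeEnd A t (y t) e := by
    intro v t
    constructor
    · intro h
      by_cases h' : ∃ t, ∃ e, v = edgeEnd A t (y t) e
      · simp only [loc, dif_pos h', Option.some_inj] at h
        exact h ▸ h'.choose_spec
      · simp only [loc, dif_neg h', reduceCtorEq] at h
    · rintro ⟨e, he⟩
      have h' : ∃ t, ∃ e, v = edgeEnd A t (y t) e := ⟨t, e, he⟩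
      simp only [loc, dif_pos h', Option.some_inj]
      obtain ⟨e', he'⟩ := h'.choose_spec
      by_contra hne
      exact hy _ _ hne e e' none (he.symm.trans he')
  -- The default `0` is harmless: if no special colour of `B` contains the gadget edge, only the
  -- open case arises, and it works for every kind.
  let kind : V → Fin 4 := fun v =>
    if h : ∃ s, ∃ t, loc v = some t ∧ B.mate (.inl s) v = A.mate (.inr t) v then h.choose else 0
  have loc_mate : ∀ v t, loc v = some t → loc (A.mate (.inr t) v) = some t := by
    intro v t h
    obtain ⟨e, rfl⟩ := (loc_iff _ _).1 h
    rw [mate_edgeEnd]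
    exact (loc_iff _ _).2 ⟨_, rfl⟩
  have kind_eq : ∀ v t s, loc v = some t → B.mate (.inl s) v = A.mate (.inr t) v →
      kind v = s := by
    intro v t s h hs
    have h' : ∃ s, ∃ t, loc v = some t ∧ B.mate (.inl s) v = A.mate (.inr t) v := ⟨s, t, h, hs⟩
    simp only [kind, dif_pos h']
    obtain ⟨t', ht', hs'⟩ := h'.choose_spec
    rw [h, Option.some_inj] at ht'
    rw [← ht', ← hs] at hs'
    exact Sum.inl_injective (B.mate_inj _ _ _ hs')
  refine ⟨⟨loc, kind, hpar, loc_mate, ?_, kind_eq, fun t => ⟨_, (loc_iff _ _).2 ⟨false, rfl⟩⟩,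
    ?_, ?_⟩⟩
  · intro v t h
    have hmove : ∀ s, B.mate (.inl s) v = A.mate (.inr t) v →
        B.mate (.inl s) (A.mate (.inr t) v) = A.mate (.inr t) (A.mate (.inr t) v) := fun s hs => by
      rw [← hs, B.mate_mate, hs, A.mate_mate]
    by_cases hv : ∃ s, B.mate (.inl s) v = A.mate (.inr t) v
    · obtain ⟨s, hs⟩ := hv
      rw [kind_eq v t s h hs, kind_eq _ t s (loc_mate v t h) (hmove s hs)]
    · have h₁ : ¬ ∃ s, ∃ t, loc v = some t ∧ B.mate (.inl s) v = A.mate (.inr t) v := by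
        rintro ⟨s, t', ht', hs⟩
        rw [h, Option.some_inj] at ht'
        exact hv ⟨s, ht' ▸ hs⟩
      have h₂ : ¬ ∃ s, ∃ t', loc (A.mate (.inr t) v) = some t' ∧
          B.mate (.inl s) (A.mate (.inr t) v) = A.mate (.inr t') (A.mate (.inr t) v) := by
        rintro ⟨s, t', ht', hs⟩
        rw [loc_mate v t h, Option.some_inj] at ht'
        subst ht'
        rw [A.mate_mate] at hs
        exact hv ⟨s, by rw [← hs, B.mate_mate, hs]⟩
      simp only [kind, dif_neg h₁, dif_neg h₂]
  · intro v z t t' hv hz hvz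
    obtain ⟨e, rfl⟩ := (loc_iff _ _).1 hv
    obtain ⟨e', rfl⟩ := (loc_iff _ _).1 hz
    by_cases ht : t = t'
    · subst ht
      rw [mate_edgeEnd]
      by_cases he : e = e'
      · subst he; exact absurd rfl hvz.ne
      · rw [show e' = !e by cases e <;> cases e' <;> simp_all]
    · obtain ⟨c, hc⟩ := A.exists_mate_eq _ _ hvz
      exact absurd hc.symm (hy _ _ ht e' e (some c))
  · intro v z t hv hz
    obtain ⟨e, rfl⟩ := (loc_iff _ _).1 hv
    obtain ⟨e', rfl⟩ := (loc_iff _ _).1 hz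
    rw [mate_edgeEnd]
    cases e <;> cases e' <;> simp

end Placement

/-! ### The induction step from `Q_b` to `Q_{4+b}`. -/

/-- The exchange of the first two groups of colours. -/
def swapGroups (D : Type*) : Fin 4 ⊕ (Fin 4 ⊕ D) ≃ Fin 4 ⊕ (Fin 4 ⊕ D) :=
  ((Equiv.sumAssoc _ _ _).symm.trans ((Equiv.sumComm _ _).sumCongr (.refl D))).trans
    (Equiv.sumAssoc _ _ _)

/-- Interleaving of two groups of colours. -/
def interleave : Fin 4 ⊕ Fin 4 ≃ Fin 4 ⊕ Fin 4 where
  toFun := Sum.elim ![.inl 0, .inr 0, .inl 1, .inr 1] ![.inl 2, .inr 2, .inl 3, .inr 3]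
  invFun := Sum.elim ![.inl 0, .inl 2, .inr 0, .inr 2] ![.inl 1, .inl 3, .inr 1, .inr 3]
  left_inv := by decide
  right_inv := by decide

/-- The pairs of special colours consist of one colour from each group. -/
def interleaveGroups (D : Type*) : Fin 4 ⊕ (Fin 4 ⊕ D) ≃ Fin 4 ⊕ (Fin 4 ⊕ D) :=
  ((Equiv.sumAssoc _ _ _).symm.trans (interleave.sumCongr (.refl D))).trans (Equiv.sumAssoc _ _ _)

theorem interleaveGroups_pairSwap {D : Type*} (s : Fin 4) :
    ∃ i, (interleaveGroups D (.inl s) = .inl i ∧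
        interleaveGroups D (.inl (pairSwap s)) = .inr (.inl i)) ∨
      (interleaveGroups D (.inl s) = .inr (.inl i) ∧
        interleaveGroups D (.inl (pairSwap s)) = .inl i) := by
  fin_cases s
  · exact ⟨0, Or.inl ⟨rfl, rfl⟩⟩
  · exact ⟨0, Or.inr ⟨rfl, rfl⟩⟩
  · exact ⟨1, Or.inl ⟨rfl, rfl⟩⟩
  · exact ⟨1, Or.inr ⟨rfl, rfl⟩⟩

/-- With `m` non-special colours the cube has `2 ^ (m + 4)` vertices, which leaves room for the
greedy choice of gadget edges. -/
theorem card_bound (m : ℕ) : (m - 1) * (4 * (m + 5)) < 2 ^ (m + 4) := by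
  rcases m with _ | m
  · simp
  induction m with
  | zero => simp
  | succ m ih =>
    rw [show m + 1 + 1 + 4 = m + 1 + 4 + 1 by ring, pow_succ]
    have h : 64 * 2 ^ m = 2 * 2 ^ (m + 1 + 4) := by ring
    have h2 : m < 2 ^ m := Nat.lt_two_pow_self
    simp only [Nat.add_sub_cancel] at ih ⊢
    rcases m with _ | m
    · simp
    · nlinarith

/-- Paired twin colourings of `Q_b` give rise to paired twin colourings of `Q_{4+b}`. -/
theorem HasPairedTwins.four_add {b : ℕ} (h : HasPairedTwins b) : HasPairedTwins (4 + b) := by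
  obtain ⟨D, _, A, B, hcard, hAB, hA, hB⟩ := h
  have hpar : ∀ x y, (hypercube b).Adj x y → hypercubeParity y = !hypercubeParity x :=
    fun _ _ => hypercubeParity_of_adj
  obtain ⟨P⟩ := nonempty_gadgetPlacement hpar A B (by
    rw [Fintype.card_finset, Fintype.card_fin, ← hcard]
    exact card_bound _)
  let N := P.coloring
  let M := layered hypercubeParity B
  let e : (cubeGraph 4).boxProd (hypercube b) ≃g hypercube (4 + b) :=
    ((cubeIso 4).boxProd .refl).trans (hypercubeBoxProdIso 4 b)
  have hNcol : ∀ i, N.mate (.inr (.inl i)) =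
      (layered hypercubeParity A).mate (.inr (.inl i)) := fun i => funext (P.mate_column i)
  have hrowB : ∀ i, Interlaced (N.mate (.inl i)) (M.mate (.inr (.inl i))) := fun i =>
    P.interlaced_row (hB i) (B.mate_mate _) (B.adj_mate _)
      (fun y t hy h => P.kind_eq y t i hy h)
      (fun x y hx => by simp [M, columnPerm_of_ne hx])
      (fun y => by simp [M, columnPerm_swapColumn])
  have hrowA : ∀ i, Interlaced (N.mate (.inl i)) (N.mate (.inr (.inl i))) := fun i => by
    rw [hNcol]
    -- The closed case cannot occur, since distinct colours of `A` share no edge.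
    exact P.interlaced_row (hA i) (A.mate_mate _) (A.adj_mate _)
      (fun y t _ h => absurd (A.mate_inj _ _ _ h) (by simp))
      (fun x y hx => by simp [columnPerm_of_ne hx])
      (fun y => by simp [columnPerm_swapColumn])
  have hcol : ∀ i, Interlaced (N.mate (.inr (.inl i))) (M.mate (.inl i)) := fun i => by
    rw [hNcol]
    exact (interlaced_layered hpar A (hA i)).symm
  have hM : ∀ i, Interlaced (M.mate (.inl i)) (M.mate (.inr (.inl i))) := fun i =>
    interlaced_layered hpar B (hB i)
  have hrest : ∀ d, Interlaced (N.mate (.inr (.inr d))) (M.mate (.inr (.inr d))) := fun d =>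
    P.interlaced_rest (hAB _)
  -- The exchange of groups in `M` makes row colours of `N` face column colours of `M` and vice
  -- versa. The new pairs are row colour `i` with column colour `i` for `i = 0, 1`; the other four
  -- join the non-special colours.
  refine ⟨Fin 4 ⊕ D, inferInstance, N.map e (interleaveGroups D),
    M.map e ((interleaveGroups D).trans (swapGroups D)), ?_, fun c => ?_, fun s => ?_, fun s => ?_⟩
  · rw [Fintype.card_sum, Fintype.card_fin]; omega
  · refine PerfectColoring.interlaced_map (k := interleaveGroups D)
      (k' := (interleaveGroups D).trans (swapGroups D)) ?_ e
    rw [Equiv.trans_apply]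
    rcases interleaveGroups D c with i | i | d
    exacts [hrowB i, hcol i, hrest d]
  · refine PerfectColoring.interlaced_map (k := interleaveGroups D)
      (k' := interleaveGroups D) ?_ e
    obtain ⟨i, ⟨h₁, h₂⟩ | ⟨h₁, h₂⟩⟩ := interleaveGroups_pairSwap (D := D) s <;> rw [h₁, h₂]
    exacts [hrowA i, (hrowA i).symm]
  · refine PerfectColoring.interlaced_map (k := (interleaveGroups D).trans (swapGroups D))
      (k' := (interleaveGroups D).trans (swapGroups D)) ?_ e
    rw [Equiv.trans_apply, Equiv.trans_apply]
    obtain ⟨i, ⟨h₁, h₂⟩ | ⟨h₁, h₂⟩⟩ := interleaveGroups_pairSwap (D := D) s <;> rw [h₁, h₂]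
    exacts [(hM i).symm, hM i]

theorem hasPairedTwins {n : ℕ} (hn : 4 ≤ n) : HasPairedTwins n := by
  induction n using Nat.strong_induction_on with
  | _ n ih =>
    rcases lt_or_ge n 8 with h | h
    · interval_cases n
      exacts [hasPairedTwins_four, hasPairedTwins_five, hasPairedTwins_six, hasPairedTwins_seven]
    · obtain ⟨m, rfl⟩ := Nat.exists_eq_add_of_le hn
      exact (ih m (by omega) (by omega)).four_add

/-- Every hypercube except possibly `Q_3` has twin colourings. -/
theorem hasTwins {n : ℕ} (hn : 1 ≤ n) (h3 : n ≠ 3) : HasTwins n := by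
  rcases lt_or_ge n 4 with h | h
  · interval_cases n
    exacts [hasTwins_one, hasTwins_two, absurd rfl h3]
  · exact (hasPairedTwins h).hasTwins

/-! ### The case `k = 3`: strands between special columns. -/

/-- The colouring of `Q_3` used in general even rows. -/
def tableEven : List ℕ := [0x11110000, 0x00001111, 0x22222222]

/-- The colouring of `Q_3` used in odd rows. -/
def tableOdd : List ℕ := [0x22002200, 0x11111111, 0x00220022]

/-- The colouring of `Q_3` used in one even row. -/
def tableExceptional : List ℕ := [0x00220022, 0x22002200, 0x11111111]

/-- The colouring of the rows of a block; the second argument is the parity of the row. -/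
def blockColoring (e : Bool) : Bool → PerfectColoring (cubeGraph 3) (Fin 3)
  | true => tableColoring tableOdd 3 (by decide +kernel)
  | false => if e = true then tableColoring tableExceptional 3 (by decide +kernel)
    else tableColoring tableEven 3 (by decide +kernel)

/-- The columns that are not coloured as the others. -/
def IsSpecialColumn (x : Fin (2 ^ 3)) : Prop := x = 0 ∨ x = 3 ∨ x = 5

instance : DecidablePred IsSpecialColumn := fun x =>
  inferInstanceAs (Decidable (x = 0 ∨ x = 3 ∨ x = 5))

/-- The row steps in a block. -/
def blockMate (e : Bool) (c : Fin 3) (z : Fin (2 ^ 3) × Bool) : Fin (2 ^ 3) × Bool :=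
  ((blockColoring e z.2).mate c z.1, z.2)

/-- The steps between the rows of a block. -/
def blockFlip (z : Fin (2 ^ 3) × Bool) : Fin (2 ^ 3) × Bool :=
  if IsSpecialColumn z.1 then z else (z.1, !z.2)

/-- The special column in which a path through a block ends, depending on that in which
it starts. -/
def strand (e : Bool) (c : Fin 3) (x : Fin (2 ^ 3)) : Fin (2 ^ 3) :=
  if c = 0 then if e = true then Equiv.swap 0 5 x else Equiv.swap 3 5 x
  else if e = true then if x = 0 then 3 else if x = 3 then 5 else 0
  else x

/-- A block has rungs only outside the special columns, so its strands start and end in special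
columns, one end in each row. -/
theorem strand_mem_orbitList : ∀ e c x, IsSpecialColumn x →
    (strand e c x, true) ∈ orbitList (blockMate e c) blockFlip 8 (x, false) := by
  decide +kernel

/-- The strands cover the block, so it suffices to connect the special columns. -/
theorem exists_mem_orbitList : ∀ e c z, ∃ x, IsSpecialColumn x ∧
    z ∈ orbitList (blockMate e c) blockFlip 8 (x, false) := by
  decide +kernel

section Strands

variable {V : Type*} [Fintype V] {f f' : V → V} (h : Interlaced f f')
  (hff : ∀ y, f (f y) = y) (hf : ∀ y, f y ≠ y) (hff' : ∀ y, f' (f' y) = y) (hf' : ∀ y, f' y ≠ y)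
  {par : V → Bool} (hpar : ∀ y, par (f y) = !par y) {y₀ : V}
  (r : Setoid (Fin (2 ^ 3) × V)) (hr' : ∀ x y, IsSpecialColumn x → r (x, y) (x, f' y))
include h hff hf hff' hf' hpar hr'

/-- A special column in which the general strands end where they start is connected. -/
theorem rel_special_column {x : Fin (2 ^ 3)} (hx : IsSpecialColumn x)
    (hr : ∀ y, par y = false → y ≠ y₀ → r (x, y) (x, f y)) (y y' : V) : r (x, y) (x, y') := by
  refine h.rel_of_cut_edge hff hf hff' hf' r (fun y => (x, y)) y₀ (fun y h₁ h₂ => ?_)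
    (fun y => hr' x y hx) y y'
  cases hy : par y
  · exact hr y hy h₁
  · have := hr (f y) (by rw [hpar, hy]; rfl) (fun h => h₂ (by rw [← h, hff]))
    rw [hff] at this
    exact r.symm this

/-- Each special column is a Hamilton cycle with at most one edge removed, hence connected; the
exceptional strands lead from column 0 to 3 and from 3 to 5. -/
theorem rel_of_cyclic_strands (hr : ∀ x y, IsSpecialColumn x → par y = false → y ≠ y₀ →
      r (x, y) (x, f y)) (h₀ : r (0, y₀) (3, f y₀)) (h₃ : r (3, y₀) (5, f y₀))
    (x : Fin (2 ^ 3)) (hx : IsSpecialColumn x) (y : V) : r (0, y₀) (x, y) := by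
  have col : ∀ x, IsSpecialColumn x → ∀ y y', r (x, y) (x, y') := fun x hx =>
    rel_special_column h hff hf hff' hf' hpar r hr' hx (hr x · hx)
  have h₃' : ∀ y, r (0, y₀) (3, y) := fun y => r.trans h₀ (col 3 (by decide) _ _)
  rcases hx with rfl | rfl | rfl
  · exact col 0 (by decide) _ _
  · exact h₃' y
  · exact r.trans (h₃' y₀) (r.trans h₃ (col 5 (by decide) _ _))

theorem rel_of_swapped_strands (hcard : 4 ∣ Fintype.card V)
    (hr₀ : ∀ y, par y = false → y ≠ y₀ → r (0, y) (0, f y))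
    (hr₃ : ∀ y, par y = false → y ≠ y₀ → r (3, y) (5, f y))
    (hr₅ : ∀ y, par y = false → y ≠ y₀ → r (5, y) (3, f y))
    (h₀ : r (0, y₀) (5, f y₀)) (h₅ : r (5, y₀) (0, f y₀)) (h₃ : r (3, y₀) (3, f y₀))
    (x : Fin (2 ^ 3)) (hx : IsSpecialColumn x) (y : V) : r (0, y₀) (x, y) := by
  classical
  have col := rel_special_column h hff hf hff' hf' hpar r hr' (x := 0) (by decide) hr₀
  have h₅₀ : r (5, y₀) (0, y₀) := r.trans h₅ (col _ _)
  have h₅₁ : r (5, f y₀) (0, y₀) := r.symm h₀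
  have hr₃' : ∀ y, y ≠ y₀ → y ≠ f y₀ → r (3, y) (5, f y) := fun y h₁ h₂ => by
    cases hy : par y
    · exact hr₃ y hy h₁
    · have := hr₅ (f y) (by rw [hpar, hy]; rfl) (fun h => h₂ (by rw [← h, hff]))
      rw [hff] at this
      exact r.symm this
  have hr₅' : ∀ y, y ≠ y₀ → y ≠ f y₀ → r (5, y) (3, f y) := fun y h₁ h₂ => by
    have := hr₃' (f y) (fun h => h₂ (by rw [← h, hff])) (fun h => h₁ (by rw [← hff y, h, hff]))
    rw [hff] at this
    exact r.symm this
  -- Otherwise the class of `(3, y₀)` meets columns 5 and 3 in complementary sets `A` and `B`, which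
  -- `f` exchanges except that `y₀` and `f y₀` both lie in `B`. So `B` has two elements more than
  -- `A`; as `A` is closed under `f'`, its size is even, and the total is 2 modulo 4.
  have h₃₅ : r (3, y₀) (5, y₀) := by
    by_contra hne
    let A : Finset V := Finset.univ.filter fun y => r (5, y) (3, y₀)
    let B : Finset V := Finset.univ.filter fun y => r (3, y) (3, y₀)
    have memA : ∀ y, y ∈ A ↔ r (5, y) (3, y₀) := fun y => by simp [A]
    have memB : ∀ y, y ∈ B ↔ r (3, y) (3, y₀) := fun y => by simp [B]
    have hA₀ : y₀ ∉ A := fun h => hne (r.symm ((memA _).1 h))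
    have hA₁ : f y₀ ∉ A := fun h =>
      hne (r.trans (r.symm ((memA _).1 h)) (r.trans h₅₁ (r.symm h₅₀)))
    have hB₀ : y₀ ∈ B := (memB _).2 (r.refl _)
    have hB₁ : f y₀ ∈ B := (memB _).2 (r.symm h₃)
    have hA' : ∀ y, y ∈ A ↔ f' y ∈ A := fun y => by
      rw [memA, memA]
      have := hr' 5 y (by decide)
      exact ⟨r.trans (r.symm this), r.trans this⟩
    have hB' : ∀ y, y ∈ B ↔ f' y ∈ B := fun y => by
      rw [memB, memB]
      have := hr' 3 y (by decide)
      exact ⟨r.trans (r.symm this), r.trans this⟩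
    have hAB : ∀ y, y ≠ y₀ → y ≠ f y₀ → (y ∈ A ↔ f y ∈ B) := fun y h₁ h₂ => by
      rw [memA, memB]
      exact ⟨r.trans (r.symm (hr₅' y h₁ h₂)), r.trans (hr₅' y h₁ h₂)⟩
    have hBA : ∀ y, y ≠ y₀ → y ≠ f y₀ → (y ∈ B ↔ f y ∈ A) := fun y h₁ h₂ => by
      rw [memA, memB]
      exact ⟨r.trans (r.symm (hr₃' y h₁ h₂)), r.trans (hr₃' y h₁ h₂)⟩
    have hdisj : Disjoint A B := by
      rw [Finset.disjoint_left]
      intro y hyA hyB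
      refine hA₀ (h.mem_of_invariant {y | y ∈ A ∧ y ∈ B} (fun y => ?_)
        (fun y => and_congr (hA' y) (hB' y)) ⟨hyA, hyB⟩ y₀).1
      by_cases h₁ : y = y₀
      · subst h₁; simp [hA₀, hA₁]
      by_cases h₂ : y = f y₀
      · subst h₂; simp [hff, hA₀, hA₁]
      · exact ⟨fun ⟨a, b⟩ => ⟨(hBA y h₁ h₂).1 b, (hAB y h₁ h₂).1 a⟩,
          fun ⟨a, b⟩ => ⟨(hAB y h₁ h₂).2 b, (hBA y h₁ h₂).2 a⟩⟩
    have hunion : A ∪ B = Finset.univ := by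
      refine Finset.eq_univ_of_forall fun y => ?_
      rw [Finset.mem_union]
      refine h.mem_of_invariant {y | y ∈ A ∨ y ∈ B} (fun y => ?_)
        (fun y => or_congr (hA' y) (hB' y)) (Or.inr hB₀) y
      by_cases h₁ : y = y₀
      · subst h₁; simp [hB₀, hB₁]
      by_cases h₂ : y = f y₀
      · subst h₂; simp [hff, hB₀, hB₁]
      · change (y ∈ A ∨ y ∈ B) ↔ (f y ∈ A ∨ f y ∈ B)
        rw [hAB y h₁ h₂, hBA y h₁ h₂, or_comm]
    have hBeq : B = insert y₀ (insert (f y₀) (A.image f)) := by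
      ext y
      simp only [Finset.mem_insert, Finset.mem_image]
      by_cases h₁ : y = y₀
      · simp [h₁, hB₀]
      by_cases h₂ : y = f y₀
      · simp [h₂, hB₁]
      · rw [hBA y h₁ h₂]
        simp only [h₁, h₂, false_or]
        exact ⟨fun h => ⟨_, h, hff y⟩, fun ⟨z, hz, hzy⟩ => by rw [← hzy, hff]; exact hz⟩
    have hcardB : B.card = A.card + 2 := by
      rw [hBeq, Finset.card_insert_of_notMem, Finset.card_insert_of_notMem,
        Finset.card_image_of_injective _ (Function.LeftInverse.injective hff)]
      · rw [Finset.mem_image]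
        rintro ⟨z, hz, hzy⟩
        exact hA₀ (by rw [← hff y₀, ← hzy, hff]; exact hz)
      · rw [Finset.mem_insert, Finset.mem_image]
        rintro (hy | ⟨z, hz, hzy⟩)
        · exact hf _ hy.symm
        · exact hA₁ (by rw [← hzy, hff]; exact hz)
    have hEven : Even A.card := A.even_card_of_fixedPointFree f' (fun y hy => (hA' y).1 hy) hff' hf'
    have htotal : A.card + B.card = Fintype.card V := by
      rw [← Finset.card_union_of_disjoint hdisj, hunion, Finset.card_univ]
    obtain ⟨a, ha⟩ := hEven
    omega
  have key : ∀ y, r (3, y) (0, y₀) ∧ r (5, y) (0, y₀) := by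
    intro y
    have h₃₀ := r.trans h₃₅ h₅₀
    have h₃₁ := r.trans (r.symm h₃) h₃₀
    refine h.mem_of_invariant {y | r (3, y) (0, y₀) ∧ r (5, y) (0, y₀)} (fun y => ?_) (fun y => ?_)
      (x := y₀) ⟨h₃₀, h₅₀⟩ y
    · by_cases h₁ : y = y₀
      · subst h₁; exact iff_of_true ⟨h₃₀, h₅₀⟩ ⟨h₃₁, h₅₁⟩
      by_cases h₂ : y = f y₀
      · subst h₂
        refine iff_of_true ⟨h₃₁, h₅₁⟩ ?_
        rw [hff]
        exact ⟨h₃₀, h₅₀⟩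
      · have a := hr₃' y h₁ h₂
        have b := hr₅' y h₁ h₂
        exact ⟨fun ⟨u, v⟩ => ⟨r.trans (r.symm b) v, r.trans (r.symm a) u⟩,
          fun ⟨u, v⟩ => ⟨r.trans a v, r.trans b u⟩⟩
    · have a := hr' 3 y (by decide)
      have b := hr' 5 y (by decide)
      exact ⟨fun ⟨u, v⟩ => ⟨r.trans (r.symm a) u, r.trans (r.symm b) v⟩,
        fun ⟨u, v⟩ => ⟨r.trans a u, r.trans b v⟩⟩
  rcases hx with rfl | rfl | rfl
  · exact col _ _
  · exact r.symm (key y).1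
  · exact r.symm (key y).2

end Strands

/-- Each even row `y` forms a block with its mate row under `F₀`, the block at `∅` being
exceptional. Colour 0 permutes the strands differently from colours 1 and 2, hence the two closing
arguments. -/
theorem HasTwins.hasSemiPerfect_three {l : ℕ} (hl : 2 ≤ l) (hT : HasTwins l) :
    HasSemiPerfect 3 l := by
  obtain ⟨F₀, F₁, hF⟩ := hT
  let M := PerfectColoring.boxProd
    (fun y : Finset (Fin l) => blockColoring (decide (y = ∅)) (hypercubeParity y))
    (fun x => if IsSpecialColumn x then F₁ else F₀)
  let e : (cubeGraph 3).boxProd (hypercube l) ≃g hypercube (3 + l) :=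
    ((cubeIso 3).boxProd .refl).trans (hypercubeBoxProdIso 3 l)
  refine ⟨M.map e (.refl _), fun c d =>
    PerfectColoring.interlaced_map (k := .refl _) (k' := .refl _) ?_ e⟩
  intro r hrow hcol
  change ∀ z, r z (M.mate (.inl c) z) at hrow
  change ∀ z, r z (M.mate (.inr d) z) at hcol
  have hpar : ∀ y, hypercubeParity (F₀.mate d y) = !hypercubeParity y := fun y =>
    hypercubeParity_of_adj (F₀.adj_mate d y)
  have hcol₀ : ∀ x y, ¬ IsSpecialColumn x → r (x, y) (x, F₀.mate d y) := fun x y hx => by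
    have := hcol (x, y)
    simpa [M, PerfectColoring.boxProd, hx] using this
  have hcol₁ : ∀ x y, IsSpecialColumn x → r (x, y) (x, F₁.mate d y) := fun x y hx => by
    have := hcol (x, y)
    simpa [M, PerfectColoring.boxProd, hx] using this
  have hwalk : ∀ y x z, hypercubeParity y = false →
      z ∈ orbitList (blockMate (decide (y = ∅)) c) blockFlip 8 (x, false) →
      r (x, y) (z.1, if z.2 then F₀.mate d y else y) := by
    intro y x z hy hz
    refine of_mem_orbitList (P := fun z => r (x, y) (z.1, if z.2 then F₀.mate d y else y))
      (fun z h => r.trans h ?_) (fun z h => r.trans h ?_) 8 (x, false) (r.refl _) z hz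
    · obtain ⟨z, ρ⟩ := z
      have := hrow (z, if ρ then F₀.mate d y else y)
      cases ρ
      · simpa [M, PerfectColoring.boxProd, hy, blockMate] using this
      · simpa [M, PerfectColoring.boxProd, hy, hpar, blockMate, blockColoring] using this
    · obtain ⟨z, ρ⟩ := z
      by_cases h₁ : IsSpecialColumn z
      · rw [show blockFlip (z, ρ) = (z, ρ) from if_pos h₁]
      · rw [show blockFlip (z, ρ) = (z, !ρ) from if_neg h₁]
        cases ρ
        · exact hcol₀ z y h₁
        · exact r.symm (hcol₀ z y h₁)
  have hstrand : ∀ y x, hypercubeParity y = false → IsSpecialColumn x →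
      r (x, y) (strand (decide (y = ∅)) c x, F₀.mate d y) := fun y x hy hx =>
    hwalk y x (_, true) hy (strand_mem_orbitList _ c x hx)
  have hspecial : ∀ x, IsSpecialColumn x → ∀ y, r (0, ∅) (x, y) := by
    have hpar₀ : hypercubeParity (∅ : Finset (Fin l)) = false := by simp [hypercubeParity]
    have hgen : ∀ x y, IsSpecialColumn x → hypercubeParity y = false → y ≠ ∅ →
        r (x, y) (strand false c x, F₀.mate d y) := fun x y hx hy hne => by
      have := hstrand y x hy hx
      rwa [decide_eq_false hne] at this
    have hexc : ∀ x, IsSpecialColumn x → r (x, ∅) (strand true c x, F₀.mate d ∅) := fun x hx => by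
      have := hstrand ∅ x hpar₀ hx
      rwa [decide_eq_true rfl] at this
    by_cases hc : c = 0
    · subst hc
      refine rel_of_swapped_strands (hF d) (F₀.mate_mate d) (F₀.mate_ne d) (F₁.mate_mate d)
        (F₁.mate_ne d) hpar r hcol₁ ?_ (fun y => hgen 0 y (by decide))
        (fun y => hgen 3 y (by decide)) (fun y => hgen 5 y (by decide)) (hexc 0 (by decide))
        (hexc 5 (by decide)) (hexc 3 (by decide))
      -- Divisibility of `2 ^ l` by four needs `l ≥ 2`.
      rw [Fintype.card_finset, Fintype.card_fin]
      exact pow_dvd_pow 2 hl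
    · have h₁ : ∀ x, strand false c x = x := fun x => by simp [strand, hc]
      have h₂ : strand true c 0 = 3 := by simp [strand, hc]
      have h₃ : strand true c 3 = 5 := by simp [strand, hc]
      refine rel_of_cyclic_strands (hF d) (F₀.mate_mate d) (F₀.mate_ne d) (F₁.mate_mate d)
        (F₁.mate_ne d) hpar r hcol₁ (fun x y hx hy hne => ?_) ?_ ?_
      · have := hgen x y hx hy hne
        rwa [h₁] at this
      · have := hexc 0 (by decide)
        rwa [h₂] at this
      · have := hexc 3 (by decide)
        rwa [h₃] at this
  have hall : ∀ z, r (0, ∅) z := by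
    rintro ⟨x, y⟩
    cases hy : hypercubeParity y
    · obtain ⟨x', hx', h⟩ := exists_mem_orbitList (decide (y = ∅)) c (x, false)
      exact r.trans (hspecial x' hx' y) (hwalk y x' _ hy h)
    · obtain ⟨x', hx', h⟩ := exists_mem_orbitList (decide (F₀.mate d y = ∅)) c (x, true)
      have := r.trans (hspecial x' hx' _) (hwalk _ x' _ (by rw [hpar, hy]; rfl) h)
      simpa [F₀.mate_mate] using this
  exact fun z z' => r.trans (r.symm (hall z)) (hall z')

theorem hasSemiPerfect_three {l : ℕ} (hl : 1 ≤ l) (h3 : l ≠ 3) : HasSemiPerfect 3 l := by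
  rcases hl.eq_or_lt with rfl | hl'
  · exact hasSemiPerfect_three_one
  · exact (hasTwins hl h3).hasSemiPerfect_three hl'

theorem hasSemiPerfect {k l : ℕ} (hk : 1 ≤ k) (hl : 1 ≤ l) (hkl : ¬ (k = 3 ∧ l = 3)) :
    HasSemiPerfect k l := by
  by_cases hk3 : k = 3
  · subst hk3
    exact hasSemiPerfect_three hl fun h => hkl ⟨rfl, h⟩
  by_cases hl3 : l = 3
  · subst hl3
    exact (hasSemiPerfect_three hk hk3).symm
  · exact (hasTwins hk hk3).hasSemiPerfect (hasTwins hl hl3)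

theorem theorem2 (k l : ℕ) (hk : 1 ≤ k) (hl : 1 ≤ l) (hkl : ¬ (k = 3 ∧ l = 3)) :
    ∃ M : OneFactorization (hypercube (k + l)) (Fin (k + l)),
      Nonempty (M.hamiltonPairGraph ≃g completeBipartiteGraph (Fin k) (Fin l)) ∧
      M.IsSemiPerfect k := by
  obtain ⟨A, hA⟩ := hasSemiPerfect hk hl hkl
  exact A.exists_isSemiPerfect hk hl hA
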